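/- **Theorem.** Fix $d\in\mathbb N$, $\alpha\in(0,1)$, $\gamma\in(0,1]$, $h\in\mathbb R$, $\lambda>0$, $\rho,L\ge 0$, and $\epsilon_0>0$ with $[1-\alpha-\epsilon_0,\,1-\alpha+\epsilon_0]\subset(0,1)$. Let $\varepsilon_1=\varepsilon_1(n)$ and $\delta=\delta(n)>0$ satisfy $\varepsilon_1\to0$, $\varepsilon_1 n\to\infty$, $\delta=O(n^{-1})$ and $\log(1/\delta)=O(\log n)$. *Setting, for a given $n$.* Let $Z_i=(X_i,Y_i)$, $i=1,\dots,n+1$, be i.i.d. with values in $\mathcal X\times\mathcal Y$, $\mathcal Y\subseteq\mathbb R$; put $\mathcal D_n=(Z_1,\dots,Z_n)$ and $\mathcal D_{n+1}=(Z_1,\dots,Z_{n+1})$. Let $\mu(x;\vartheta)$, $\vartheta\in\mathbb R^d$, be a real-valued model, $\ell$ a loss, $\Omega$ a regularizer, and $$J(\vartheta;\mathcal D_n)=\frac1n\sum_{i=1}^n\ell(Y_i,\mu(X_i;\vartheta))+\Omega(\vartheta),\qquad J(\vartheta;\mathcal D_{n+1})=J(\vartheta;\mathcal D_n)+\frac1n\ell(Y_{n+1},\mu(X_{n+1};\vartheta)).$$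 Assume that $J(\cdot;D)$ is $\lambda$-strongly convex for every dataset $D$ of $n$ points and that, for all $x,y$, the map $\vartheta\mapsto\ell(y,\mu(x;\vartheta))$ is $\rho L$-Lipschitz and $\vartheta\mapsto\mu(x;\vartheta)$ is $L$-Lipschitz. Let $\hat\vartheta^{(n)}$ and $\hat\vartheta^{(n+1)}$ minimize $J(\cdot;\mathcal D_n)$ and $J(\cdot;\mathcal D_{n+1})$, and let $\widetilde\vartheta^{(n)}=\hat\vartheta^{(n)}+\zeta$ with $\zeta\sim\mathcal N(0,\sigma_1^2I_d)$ independent of the data, where $\sigma_1^2=2\log(1.25/\delta)\,\tau^2/\varepsilon_1^2$ and $\tau=2\rho L/(\lambda n)$. Define the scores $$R_i^{(n)}=|Y_i-\mu(X_i;\widetilde\vartheta^{(n)})|\ (i\le n),\qquad R_i^{(n+1)}=|Y_i-\mu(X_i;\hat\vartheta^{(n+1)})|\ (i\le n+1),$$ the ranks $k=\lceil(1-\alpha)(n+1)\rceil$ and $k'=\lceil(1-\alpha_1)(n+1)\rceil$ with $\alpha_1=e^{-\varepsilon_1}(\alpha-\delta)$, and the oracle and differential conformal intervals $$C^o_\alpha(X_{n+1})=\Big[\mu(X_{n+1};\hat\vartheta^{(n+1)})\pm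 R^{(n+1)}_{(k)}\Big],\qquad C^d_\alpha(X_{n+1})=\Big[\mu(X_{n+1};\widetilde\vartheta^{(n)})\pm R^{(n)}_{(k')}\Big],$$ where $R_{(j)}$ is the $j$-th smallest score. Let $F$ be a distribution function on $\mathbb R$ with quantile function $F^{-1}(q)=\inf\{x:F(x)\ge q\}$ such that $|F^{-1}(q_1)-F^{-1}(q_2)|\le h|q_1-q_2|^\gamma$ for all $q_1,q_2\in[1-\alpha-\epsilon_0,\,1-\alpha+\epsilon_0]$, and let $\xi_{TV}\in\mathbb R$ be such that the joint law of $(R_i^{(n)})_{i\le n}$ and the joint law of $(R_i^{(n+1)})_{i\le n+1}$ are each within total variation distance $\sup_A|P(A)-Q(A)|\le\xi_{TV}$ of the law of an i.i.d. sample (of size $n$, respectively $n+1$) from $F$. *Conclusion.* There are $C>0$ and $n_0$, depending only on $d,\alpha,\gamma,h,\epsilon_0,\lambda,\rho,L$ and the sequences $\varepsilon_1,\delta$, such that for every $n\ge n_0$, every setting as above and every $t>0$, with $\mathrm{Leb}$ the Lebesgue measure, $$\Pr\Big(\mathrm{Leb}\big(C^o_\alpha(X_{n+1})\,\triangle\,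 C^d_\alpha(X_{n+1})\big)>C(\varepsilon_1^\gamma+t)\Big)\le C\Big(\exp\Big(-\frac{\varepsilon_1^2n^2t^2}{\log n}\Big)+\frac1{\varepsilon_1n}\Big)+2\xi_{TV}.$$ -/

import Mathlib

open Set Filter Topology Asymptotics MeasureTheory ProbabilityTheory
open scoped NNReal

noncomputable section

namespace DPCP

/-- Total variation distance, `sup |P(A) - Q(A)|` over all measurable sets `A`. It is meant for
finite measures, for which the supremum is over a bounded family. -/
def tvDist {S : Type*} [MeasurableSpace S] (P Q : Measure S) : ℝ :=
  ⨆ A : {A : Set S // MeasurableSet A}, |P.real A.1 - Q.real A.1|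

/-- The random variables `R_1, …, R_m` are `ξ`-approximately i.i.d. with idealized marginal law
`ν`: their joint law is within `ξ` in total variation of the law of an i.i.d. sample of `ν`. -/
def IsApproxIID {Ω : Type*} [MeasurableSpace Ω] (P : Measure Ω) {m : ℕ} (R : Fin m → Ω → ℝ)
    (ν : Measure ℝ) (ξ : ℝ) : Prop :=
  (∀ i, AEMeasurable (R i) P) ∧
    tvDist (P.map (fun ω i => R i ω)) (Measure.pi (fun _ : Fin m => ν)) ≤ ξ

/-- The quantile function `F⁻¹(q) = inf {x : q ≤ F(x)}` of a distribution function `F`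
(used for `0 < q < 1`). -/
def quantile (F : ℝ → ℝ) (q : ℝ) : ℝ := sInf {x : ℝ | q ≤ F x}

/-- The `k`-th smallest of the numbers `R_1, …, R_m`, counted with multiplicity, for
`1 ≤ k ≤ m`; the value for other `k` is a placeholder. -/
def orderStat {m : ℕ} (R : Fin m → ℝ) (k : ℕ) : ℝ :=
  if hk : 0 < k ∧ k ≤ m then R (Tuple.sort R ⟨k - 1, by omega⟩) else 0

/-- The regularized empirical risk
`J(ϑ; D_n) = (1/n) ∑_{i ≤ n} ℓ(y_i, μ(x_i; ϑ)) + reg(ϑ)`. -/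
def risk {𝒳 𝒴 Θ : Type*} (ℓ : 𝒴 → ℝ → ℝ) (μ : 𝒳 → Θ → ℝ) (reg : Θ → ℝ) {n : ℕ}
    (D : Fin n → 𝒳 × 𝒴) (ϑ : Θ) : ℝ :=
  1 / (n : ℝ) * ∑ i, ℓ (D i).2 (μ (D i).1 ϑ) + reg ϑ

/-- The first `n` points of a dataset of `n + 1` points. -/
def initial {S : Type*} {n : ℕ} (D : Fin (n + 1) → S) : Fin n → S := fun i => D i.castSucc

/-- The risk of the augmented dataset (the last point is the added one):
`J(ϑ; D_{n+1}) = J(ϑ; D_n) + (1/n) ℓ(y_{n+1}, μ(x_{n+1}; ϑ))`, normalized by `n`. -/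
def augRisk {𝒳 𝒴 Θ : Type*} (ℓ : 𝒴 → ℝ → ℝ) (μ : 𝒳 → Θ → ℝ) (reg : Θ → ℝ) {n : ℕ}
    (D : Fin (n + 1) → 𝒳 × 𝒴) (ϑ : Θ) : ℝ :=
  risk ℓ μ reg (initial D) ϑ
    + 1 / (n : ℝ) * ℓ (D (Fin.last n)).2 (μ (D (Fin.last n)).1 ϑ)

/-- The sensitivity bound `τ = 2ρL / (λn)` of the ERM estimator. -/
def sensitivity (ρ L lam : ℝ) (n : ℕ) : ℝ := 2 * ρ * L / (lam * n)

/-- The variance `σ₁² = 2 log(1.25/δ) τ² / ε₁²` of the Gaussian mechanism. -/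
def noiseVar (τ ε₁ δ : ℝ) : ℝ := 2 * Real.log (1.25 / δ) * τ ^ 2 / ε₁ ^ 2

/-- The absolute residual score `|y - μ(x; ϑ)|`; responses lie in a set `𝒴` of reals. -/
def score {𝒳 Θ : Type*} {𝒴 : Set ℝ} (μ : 𝒳 → Θ → ℝ) (z : 𝒳 × 𝒴) (ϑ : Θ) : ℝ :=
  |(z.2 : ℝ) - μ z.1 ϑ|

/-- The adjusted level `α₁ = exp(-ε₁) (α - δ)`. -/
def adjLevel (α ε₁ δ : ℝ) : ℝ := Real.exp (-ε₁) * (α - δ)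

/-- The rank `⌈(1 - β)(n + 1)⌉`. -/
def rank (β : ℝ) (n : ℕ) : ℕ := ⌈(1 - β) * ((n : ℝ) + 1)⌉₊

/-- The oracle conformal interval at `x_{n+1}` for the parameter `ϑ` (to be fitted on all `n + 1`
points): its radius is an order statistic of all `n + 1` scores. -/
def oracleInterval {𝒳 Θ : Type*} {𝒴 : Set ℝ} (μ : 𝒳 → Θ → ℝ) (α : ℝ) {n : ℕ}
    (D : Fin (n + 1) → 𝒳 × 𝒴) (ϑ : Θ) : Set ℝ :=
  let a := μ (D (Fin.last n)).1 ϑ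
  let r := orderStat (fun i => score μ (D i) ϑ) (rank α n)
  Icc (a - r) (a + r)

/-- The differential conformal interval at `x_{n+1}` for the parameter `ϑ` (to be the private fit
on the first `n` points): its radius is an order statistic of the first `n` scores, with rank
`⌈(1 - α₁)(n + 1)⌉`. -/
def differentialInterval {𝒳 Θ : Type*} {𝒴 : Set ℝ} (μ : 𝒳 → Θ → ℝ) (α₁ : ℝ) {n : ℕ}
    (D : Fin (n + 1) → 𝒳 × 𝒴) (ϑ : Θ) : Set ℝ :=
  let a := μ (D (Fin.last n)).1 ϑ
  let r := orderStat (fun i => score μ (initial D i) ϑ) (rank α₁ n)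
  Icc (a - r) (a + r)

end DPCP

end

/-!
The oracle scores use the parameter `ϑ'` fitted on all `n + 1` points, the differential scores the
noisy parameter `ϑ + ζ` fitted on the first `n`. Strong convexity of the smaller risk gives
`‖ϑ - ϑ'‖ ≤ τ = O(1 / n)` (`dist_argmin_le_sensitivity`), and `‖ζ‖ = O(t)` up to a Gaussian tail
(`measureReal_norm_noise_le`). Hence the centers of the two intervals, and all common scores, differ
by `O(ε₁ + t)`. Order statistics are Lipschitz in the scores, and dropping one score shifts ranks by
at most one, so the radii differ by `O(ε₁ + t)` plus a gap `R_(k + m) - R_(k)` between order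
statistics of the oracle scores alone, where `m` is of order `ε₁ n`
(`volume_symmDiff_intervals_le`).

This gap is the heart of the matter: each order statistic by itself fluctuates by `n ^ (-1 / 2)`,
which may be far larger than `ε₁`, while their difference does not. After passing to an i.i.d.
sample, at the cost of one total variation error, the quantile transform reduces to uniform
variables `U_i`. The sample is split according to which `i` has rank `k` and which set `S` of points
comes before it. Given these and `U_i`, the remaining points are independent and uniform to the
right of `U_i`, so by Chernoff's bound at least `m` of them lie within `O(m / n)` of `U_i`, up to an
exponentially small fraction of the probability of that part
(`measure_below_eq_inter_gapCount_lt_le`). The parts are disjoint, so summing gives the same bound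
for the whole sample (`measure_gapCount_lt_le`), and `exp (-m) ≤ 1 / m = O(1 / (ε₁ n))`.
Chebyshev's inequality places the gap where the quantile function is Hölder continuous, which
turns the length `O(ε₁)` into `O(ε₁ ^ γ)`.
-/

namespace DPCP

/-! ### Order statistics -/

theorem orderStat_le_iff {m : ℕ} (R : Fin m → ℝ) {k : ℕ} (hk : 0 < k) (hkm : k ≤ m) (x : ℝ) :
    orderStat R k ≤ x ↔ k ≤ (Finset.univ.filter fun i => R i ≤ x).card := by
  have h := Tuple.lt_card_le_iff_apply_le_of_monotone (j := (⟨k - 1, by omega⟩ : Fin m)) (a := x)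
    (Tuple.monotone_sort R)
  have hc : (Finset.univ.filter fun i => (R ∘ Tuple.sort R) i ≤ x).card
      = (Finset.univ.filter fun i => R i ≤ x).card := by
    refine Finset.card_equiv (Tuple.sort R) fun i => ?_
    simp
  rw [orderStat, dif_pos ⟨hk, hkm⟩]
  rw [hc] at h
  rw [Function.comp_apply] at h
  rw [← h]
  simp only
  omega

/-- If fewer than `k` of the values are below `x`, then the `k`-th smallest value is at
least `x`. -/
theorem le_orderStat_of_card_lt {m : ℕ} (R : Fin m → ℝ) {k : ℕ} (hkm : k ≤ m) {x : ℝ}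
    (h : (Finset.univ.filter fun i => R i < x).card < k) : x ≤ orderStat R k := by
  by_contra! hlt
  have h1 := (orderStat_le_iff R (by omega) hkm _).1 le_rfl
  have h2 : (Finset.univ.filter fun i => R i ≤ orderStat R k).card
      ≤ (Finset.univ.filter fun i => R i < x).card := by
    refine Finset.card_le_card fun i => ?_
    simp only [Finset.mem_filter, Finset.mem_univ, true_and]
    intro hi
    linarith
  omega

theorem orderStat_mono {m : ℕ} (R : Fin m → ℝ) {k l : ℕ} (hk : 0 < k) (hkl : k ≤ l)
    (hl : l ≤ m) : orderStat R k ≤ orderStat R l := by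
  rw [orderStat_le_iff R hk (hkl.trans hl)]
  exact hkl.trans ((orderStat_le_iff R (hk.trans_le hkl) hl _).1 le_rfl)

theorem orderStat_le_add_of_le {m : ℕ} {R S : Fin m → ℝ} {Δ : ℝ} (h : ∀ i, R i ≤ S i + Δ)
    {k : ℕ} (hk : 0 < k) (hkm : k ≤ m) : orderStat R k ≤ orderStat S k + Δ := by
  rw [orderStat_le_iff R hk hkm]
  refine ((orderStat_le_iff S hk hkm _).1 le_rfl).trans (Finset.card_le_card fun i => ?_)
  simp only [Finset.mem_filter, Finset.mem_univ, true_and]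
  intro hi
  linarith [h i]

theorem abs_orderStat_sub_le {m : ℕ} {R S : Fin m → ℝ} {Δ : ℝ} (h : ∀ i, |R i - S i| ≤ Δ)
    {k : ℕ} (hk : 0 < k) (hkm : k ≤ m) : |orderStat R k - orderStat S k| ≤ Δ := by
  have h1 : orderStat R k ≤ orderStat S k + Δ :=
    orderStat_le_add_of_le (fun i => by linarith [(abs_le.1 (h i)).2]) hk hkm
  have h2 : orderStat S k ≤ orderStat R k + Δ :=
    orderStat_le_add_of_le (fun i => by linarith [(abs_le.1 (h i)).1]) hk hkm
  rw [abs_le]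
  constructor <;> linarith

theorem card_filter_initial {m : ℕ} (R : Fin (m + 1) → ℝ) (x : ℝ) :
    (Finset.univ.filter fun i => initial R i ≤ x).card
        ≤ (Finset.univ.filter fun i => R i ≤ x).card ∧
      (Finset.univ.filter fun i => R i ≤ x).card
        ≤ (Finset.univ.filter fun i => initial R i ≤ x).card + 1 := by
  have h : (Finset.univ.filter fun i => R i ≤ x).card
      = (Finset.univ.filter fun i => initial R i ≤ x).card
        + if R (Fin.last m) ≤ x then 1 else 0 := by
    rw [Finset.card_filter, Finset.card_filter, Fin.sum_univ_castSucc]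
    rfl
  rw [h]
  constructor
  · omega
  · split_ifs <;> omega

theorem orderStat_le_orderStat_initial {m : ℕ} (R : Fin (m + 1) → ℝ) {k : ℕ} (hk : 0 < k)
    (hkm : k ≤ m) : orderStat R k ≤ orderStat (initial R) k := by
  rw [orderStat_le_iff R hk (by omega)]
  exact ((orderStat_le_iff (initial R) hk hkm _).1 le_rfl).trans (card_filter_initial R _).1

theorem orderStat_initial_le_orderStat_succ {m : ℕ} (R : Fin (m + 1) → ℝ) {k : ℕ} (hk : 0 < k)
    (hkm : k ≤ m) : orderStat (initial R) k ≤ orderStat R (k + 1) := by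
  rw [orderStat_le_iff _ hk hkm]
  have h1 := (orderStat_le_iff R (Nat.succ_pos k) (by omega) _).1 le_rfl
  have h2 := (card_filter_initial R (orderStat R (k + 1))).2
  simp only [Nat.succ_eq_add_one] at h1
  omega

theorem measurable_card_filter {ι : Type*} [Fintype ι] {B : Set ℝ} (hB : MeasurableSet B)
    [DecidablePred (· ∈ B)] :
    Measurable fun R : ι → ℝ => (Finset.univ.filter fun i => R i ∈ B).card := by
  simp only [Finset.card_filter]
  refine Finset.measurable_sum _ fun i _ => ?_
  exact Measurable.ite (measurable_pi_apply i hB) measurable_const measurable_const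

theorem measurable_orderStat {m : ℕ} (k : ℕ) :
    Measurable fun R : Fin m → ℝ => orderStat R k := by
  by_cases hk : 0 < k ∧ k ≤ m
  · refine measurable_of_Iic fun x => ?_
    have : (fun R : Fin m → ℝ => orderStat R k) ⁻¹' Iic x
        = {R | k ≤ (Finset.univ.filter fun i => R i ∈ Iic x).card} := by
      ext R
      simp [orderStat_le_iff R hk.1 hk.2]
    rw [this]
    exact measurableSet_le measurable_const (measurable_card_filter measurableSet_Iic)
  · simp only [orderStat, dif_neg hk, measurable_const]

/-! ### Stability of the fit and comparison of the intervals -/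

/-- The points that are in one of two compact intervals but not in the other lie between
the left or between the right endpoints. -/
theorem volume_symmDiff_Icc_le (a b r s : ℝ) :
    volume.real (symmDiff (Icc (a - r) (a + r)) (Icc (b - s) (b + s)))
      ≤ 2 * |a - b| + 2 * |r - s| := by
  have hsub : symmDiff (Icc (a - r) (a + r)) (Icc (b - s) (b + s))
      ⊆ uIcc (a - r) (b - s) ∪ uIcc (a + r) (b + s) := by
    intro x hx
    simp only [Set.mem_symmDiff, mem_Icc, mem_union, mem_uIcc, not_and_or, not_le] at hx ⊢
    grind
  have h1 : volume.real (symmDiff (Icc (a - r) (a + r)) (Icc (b - s) (b + s)))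
      ≤ volume.real (uIcc (a - r) (b - s) ∪ uIcc (a + r) (b + s)) :=
    measureReal_mono hsub
      (isCompact_uIcc.union isCompact_uIcc).measure_lt_top.ne
  have h2 := measureReal_union_le (μ := volume) (uIcc (a - r) (b - s)) (uIcc (a + r) (b + s))
  have h3 : ∀ x y : ℝ, volume.real (uIcc x y) = |y - x| := by
    intro x y
    rw [measureReal_def, Real.volume_interval, ENNReal.toReal_ofReal (abs_nonneg _)]
  rw [h3, h3] at h2
  have h4 : |b - s - (a - r)| ≤ |a - b| + |r - s| := by
    rw [abs_sub_comm a b]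
    have := abs_add_le (b - a) (r - s)
    rwa [show b - a + (r - s) = b - s - (a - r) by ring] at this
  have h5 : |b + s - (a + r)| ≤ |a - b| + |r - s| := by
    rw [abs_sub_comm a b, abs_sub_comm r s]
    have := abs_add_le (b - a) (s - r)
    rwa [show b - a + (s - r) = b + s - (a + r) by ring] at this
  linarith

/-- A strongly convex function grows at least quadratically around its minimizer. -/
theorem sq_dist_le_of_isMinOn {E : Type*} [NormedAddCommGroup E] [NormedSpace ℝ E]
    {f : E → ℝ} {lam : ℝ} (hf : StrongConvexOn univ lam f) {x : E} (hx : IsMinOn f univ x)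
    (y : E) : lam / 2 * ‖x - y‖ ^ 2 ≤ f y - f x := by
  -- convexity along the segment at `(1 - s) • x + s • y`, divided by `s`
  have key : ∀ s ∈ Ioo (0 : ℝ) 1, (1 - s) * (lam / 2 * ‖x - y‖ ^ 2) ≤ f y - f x := by
    intro s hs
    have h1 := hf.2 (mem_univ x) (mem_univ y) (by linarith [hs.2] : 0 ≤ 1 - s)
      hs.1.le (by ring)
    have h2 : f x ≤ f ((1 - s) • x + s • y) := hx (mem_univ _)
    simp only [smul_eq_mul] at h1
    have h3 : s * ((1 - s) * (lam / 2 * ‖x - y‖ ^ 2)) ≤ s * (f y - f x) := by nlinarith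
    exact le_of_mul_le_mul_left h3 hs.1
  have hlim : Tendsto (fun s : ℝ => (1 - s) * (lam / 2 * ‖x - y‖ ^ 2)) (𝓝[>] 0)
      (𝓝 ((1 - 0) * (lam / 2 * ‖x - y‖ ^ 2))) :=
    ((continuous_const.sub continuous_id).mul continuous_const).continuousAt.tendsto.mono_left
      nhdsWithin_le_nhds
  have := le_of_tendsto hlim (by
    filter_upwards [Ioo_mem_nhdsGT (zero_lt_one' ℝ)] with s hs using key s hs)
  simpa using this

/-- Only the risk of the smaller dataset has to be strongly convex: comparing both risks at both
minimizers, its quadratic growth is paid for by the Lipschitz loss of the added point. -/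
theorem dist_argmin_le_sensitivity {𝒳 𝒴 E : Type*} [NormedAddCommGroup E] [NormedSpace ℝ E]
    {ℓ : 𝒴 → ℝ → ℝ} {μ : 𝒳 → E → ℝ} {reg : E → ℝ} {n : ℕ} (hn : 0 < n)
    {lam : ℝ} (hlam : 0 < lam) {ρ L : ℝ≥0} {D : Fin (n + 1) → 𝒳 × 𝒴}
    (hconv : StrongConvexOn univ lam (risk ℓ μ reg (initial D)))
    (hlip : ∀ x y, LipschitzWith (ρ * L) (fun ϑ => ℓ y (μ x ϑ))) {ϑ ϑ' : E}
    (hϑ : IsMinOn (risk ℓ μ reg (initial D)) univ ϑ)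
    (hϑ' : IsMinOn (augRisk ℓ μ reg D) univ ϑ') :
    ‖ϑ - ϑ'‖ ≤ sensitivity ρ L lam n := by
  have hn' : (0 : ℝ) < n := by exact_mod_cast hn
  have h1 := sq_dist_le_of_isMinOn hconv hϑ ϑ'
  have h2 : augRisk ℓ μ reg D ϑ' ≤ augRisk ℓ μ reg D ϑ := hϑ' (mem_univ _)
  have h3 := (hlip (D (Fin.last n)).1 (D (Fin.last n)).2).dist_le_mul ϑ ϑ'
  rw [Real.dist_eq, dist_eq_norm] at h3
  push_cast at h3
  have h4 := (le_abs_self _).trans h3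
  simp only [augRisk] at h2
  set l := ℓ (D (Fin.last n)).2 (μ (D (Fin.last n)).1 ϑ)
  set l' := ℓ (D (Fin.last n)).2 (μ (D (Fin.last n)).1 ϑ')
  have h5 : lam / 2 * ‖ϑ - ϑ'‖ ^ 2 ≤ 1 / (n : ℝ) * (ρ * L * ‖ϑ - ϑ'‖) := by
    have : 1 / (n : ℝ) * (l - l') ≤ 1 / (n : ℝ) * (ρ * L * ‖ϑ - ϑ'‖) :=
      mul_le_mul_of_nonneg_left h4 (by positivity)
    linarith
  rcases (norm_nonneg (ϑ - ϑ')).eq_or_lt with h0 | h0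
  · rw [← h0, sensitivity]
    positivity
  · rw [sensitivity, le_div_iff₀ (by positivity)]
    have h6 : ‖ϑ - ϑ'‖ * (lam / 2 * ‖ϑ - ϑ'‖) ≤ ‖ϑ - ϑ'‖ * (1 / (n : ℝ) * (ρ * L)) := by
      nlinarith
    have h7 := le_of_mul_le_mul_left h6 h0
    have h8 : 1 / (n : ℝ) * (ρ * L) * (2 * n) = 2 * ρ * L := by field_simp
    nlinarith

/-- The deterministic comparison of the two intervals: their centers and the scores move by at
most `L ‖ϑ - ϑ'‖`, and the remaining difference of the radii is a gap between order statistics of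
the `n + 1` oracle scores. -/
theorem volume_symmDiff_intervals_le {𝒳 E : Type*} [NormedAddCommGroup E]
    {𝒴 : Set ℝ} {μ : 𝒳 → E → ℝ} {n : ℕ} {L : ℝ≥0} {D : Fin (n + 1) → 𝒳 × 𝒴}
    (hlip : ∀ x, LipschitzWith L (μ x)) (ϑ ϑ' : E) {α α₁ : ℝ} {m : ℕ}
    (h0 : 0 < rank α n) (h1 : rank α n ≤ rank α₁ n) (h2 : rank α₁ n ≤ n)
    (h3 : rank α₁ n + 1 ≤ rank α n + m) (h4 : rank α n + m ≤ n + 1) :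
    volume.real (symmDiff (oracleInterval μ α D ϑ') (differentialInterval μ α₁ D ϑ))
      ≤ 4 * (L * ‖ϑ - ϑ'‖)
        + 2 * (orderStat (fun i => score μ (D i) ϑ') (rank α n + m)
          - orderStat (fun i => score μ (D i) ϑ') (rank α n)) := by
  set R : Fin (n + 1) → ℝ := fun i => score μ (D i) ϑ' with hR
  set S : Fin n → ℝ := fun i => score μ (initial D i) ϑ with hS
  set k := rank α n
  set k' := rank α₁ n
  have hd : ∀ x, |μ x ϑ' - μ x ϑ| ≤ L * ‖ϑ - ϑ'‖ := by
    intro x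
    have := (hlip x).dist_le_mul ϑ' ϑ
    rwa [Real.dist_eq, dist_comm, dist_eq_norm] at this
  have hRS : ∀ i, |initial R i - S i| ≤ L * ‖ϑ - ϑ'‖ := by
    intro i
    refine le_trans ?_ (hd (D i.castSucc).1)
    simp only [hR, hS, initial, score]
    refine (abs_abs_sub_abs_le_abs_sub _ _).trans (le_of_eq ?_)
    rw [abs_sub_comm]
    congr 1
    ring
  have e1 := abs_orderStat_sub_le hRS (h0.trans_le h1) h2
  have e2 := orderStat_mono R h0 h1 (by omega)
  have e3 := orderStat_le_orderStat_initial R (h0.trans_le h1) h2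
  have e4 := orderStat_initial_le_orderStat_succ R (h0.trans_le h1) h2
  have e5 := orderStat_mono R (Nat.succ_pos k') h3 h4
  simp only [Nat.succ_eq_add_one] at e5
  have e6 : |orderStat R k - orderStat S k'|
      ≤ L * ‖ϑ - ϑ'‖ + (orderStat R (k + m) - orderStat R k) := by
    rw [abs_le] at e1 ⊢
    constructor <;> linarith
  refine (volume_symmDiff_Icc_le _ _ _ _).trans ?_
  change 2 * |μ (D (Fin.last n)).1 ϑ' - μ (D (Fin.last n)).1 ϑ|
    + 2 * |orderStat R k - orderStat S k'| ≤ _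
  linarith [hd (D (Fin.last n)).1]

/-! ### Total variation, quantiles, concentration of counts and Gaussian tails -/

theorem measureReal_sub_le_tvDist {S : Type*} [MeasurableSpace S] (P Q : Measure S)
    [IsProbabilityMeasure P] [IsProbabilityMeasure Q] {A : Set S} (hA : MeasurableSet A) :
    P.real A - Q.real A ≤ tvDist P Q := by
  refine (le_abs_self _).trans ?_
  refine le_ciSup (f := fun A : {A : Set S // MeasurableSet A} => |P.real A.1 - Q.real A.1|)
    ⟨1, ?_⟩ ⟨A, hA⟩
  rintro _ ⟨B, rfl⟩
  rw [abs_le]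
  constructor <;>
    linarith [measureReal_nonneg (μ := P) (s := B.1), measureReal_nonneg (μ := Q) (s := B.1),
      measureReal_le_one (μ := P) (s := B.1), measureReal_le_one (μ := Q) (s := B.1)]

theorem tvDist_nonneg {S : Type*} [MeasurableSpace S] (P Q : Measure S) : 0 ≤ tvDist P Q :=
  Real.iSup_nonneg fun _ => abs_nonneg _

theorem quantile_cdf_le_iff (ν : Measure ℝ) [IsProbabilityMeasure ν] {u : ℝ}
    (hu : u ∈ Ioo (0 : ℝ) 1) (x : ℝ) : quantile (cdf ν) u ≤ x ↔ u ≤ cdf ν x := by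
  have hbdd : BddBelow {x : ℝ | u ≤ cdf ν x} := by
    obtain ⟨b, hb⟩ := ((tendsto_cdf_atBot ν).eventually (gt_mem_nhds hu.1)).exists
    refine ⟨b, fun y (hy : u ≤ cdf ν y) => ?_⟩
    by_contra! hlt
    linarith [monotone_cdf ν hlt.le]
  have hne : {x : ℝ | u ≤ cdf ν x}.Nonempty := by
    obtain ⟨b, hb⟩ := ((tendsto_cdf_atTop ν).eventually (lt_mem_nhds hu.2)).exists
    exact ⟨b, hb.le⟩
  refine ⟨fun h => ?_, fun h => csInf_le hbdd h⟩
  -- right continuity of the distribution function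
  have hcont : Tendsto (cdf ν) (𝓝[>] x) (𝓝 (cdf ν x)) :=
    ((cdf ν).right_continuous x).mono_left (nhdsWithin_mono _ Ioi_subset_Ici_self)
  refine ge_of_tendsto hcont ?_
  filter_upwards [self_mem_nhdsWithin] with y hy
  obtain ⟨z, hz, hzy⟩ := exists_lt_of_csInf_lt hne (h.trans_lt hy)
  exact le_trans hz (monotone_cdf ν hzy.le)

theorem monotoneOn_quantile_cdf (ν : Measure ℝ) [IsProbabilityMeasure ν] :
    MonotoneOn (quantile (cdf ν)) (Ioo 0 1) := by
  intro u hu v hv huv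
  rw [quantile_cdf_le_iff ν hu]
  exact huv.trans ((quantile_cdf_le_iff ν hv _).1 le_rfl)

/-- The uniform distribution on the unit interval. -/
noncomputable def unif : Measure ℝ := volume.restrict (Ioo 0 1)

instance : IsProbabilityMeasure unif := ⟨by simp [unif]⟩

theorem unif_Ioc {a b : ℝ} (ha : 0 ≤ a) (hb : b ≤ 1) :
    unif (Ioc a b) = ENNReal.ofReal (b - a) := by
  rw [unif, Measure.restrict_congr_set Ioo_ae_eq_Ioc, Measure.restrict_apply measurableSet_Ioc,
    inter_eq_left.2 (Ioc_subset_Ioc ha hb), Real.volume_Ioc]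

theorem unif_inter_Ioo (B : Set ℝ) : unif (B ∩ Ioo 0 1) = unif B := by
  rw [unif, Measure.restrict_apply' measurableSet_Ioo, Measure.restrict_apply' measurableSet_Ioo,
    inter_assoc, inter_self]

theorem unif_Iic {a : ℝ} (ha : a ≤ 1) : unif (Iic a) = ENNReal.ofReal a := by
  rw [← unif_inter_Ioo, ← sub_zero a, ← unif_Ioc le_rfl (by simpa using ha), sub_zero,
    ← unif_inter_Ioo (Ioc 0 a)]
  congr 1
  ext x
  simp only [mem_inter_iff, mem_Iic, mem_Ioo, mem_Ioc]
  tauto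

theorem unif_Ioi {a : ℝ} (ha : 0 ≤ a) : unif (Ioi a) = ENNReal.ofReal (1 - a) := by
  rw [← unif_inter_Ioo, ← unif_Ioc ha le_rfl, ← unif_inter_Ioo (Ioc a 1)]
  congr 1
  ext x
  simp only [mem_inter_iff, mem_Ioi, mem_Ioo, mem_Ioc]
  constructor
  · rintro ⟨h1, h2, h3⟩
    exact ⟨⟨h1, h3.le⟩, h2, h3⟩
  · rintro ⟨⟨h1, _⟩, h2, h3⟩
    exact ⟨h1, h2, h3⟩

instance : NullSingletonClass unif := by
  unfold unif
  infer_instance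

theorem aemeasurable_quantile_cdf (ν : Measure ℝ) [IsProbabilityMeasure ν] :
    AEMeasurable (quantile (cdf ν)) unif :=
  aemeasurable_restrict_of_monotoneOn measurableSet_Ioo (monotoneOn_quantile_cdf ν)

/-- The quantile transform: `F⁻¹(U)` has distribution function `F` if `U` is uniform. -/
theorem map_quantile_cdf_unif (ν : Measure ℝ) [IsProbabilityMeasure ν] :
    unif.map (quantile (cdf ν)) = ν := by
  have := Measure.isProbabilityMeasure_map (aemeasurable_quantile_cdf ν)
  refine Measure.ext_of_Iic _ _ fun x => ?_
  rw [Measure.map_apply_of_aemeasurable (aemeasurable_quantile_cdf ν) measurableSet_Iic,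
    ← ofReal_cdf, ← unif_Iic (cdf_le_one ν x), ← unif_inter_Ioo, ← unif_inter_Ioo (Iic _)]
  congr 1
  ext u
  simp only [mem_inter_iff, mem_preimage, mem_Iic, and_congr_left_iff]
  exact fun hu => quantile_cdf_le_iff ν hu x

/-- Chebyshev's inequality for the number of sample points in a set. -/
theorem measureReal_card_filter_le {N : ℕ} (hN : 0 < N) (κ : Measure ℝ)
    [IsProbabilityMeasure κ] {B : Set ℝ} (hB : MeasurableSet B)
    [DecidablePred (· ∈ B)] {r : ℝ} (hr : 0 < r) :
    (Measure.pi fun _ : Fin N => κ).real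
      {U | N * r ≤ |((Finset.univ.filter fun i => U i ∈ B).card : ℝ) - N * κ.real B|}
      ≤ 1 / (N * r ^ 2) := by
  have hN' : (0 : ℝ) < N := by exact_mod_cast hN
  set f : ℝ → ℝ := B.indicator 1 with hf
  have hmem : ∀ x, f x ∈ Icc (0 : ℝ) 1 := by
    intro x
    by_cases hx : x ∈ B <;> simp [hf, hx]
  have hfm : Measurable f := measurable_one.indicator hB
  have hL2 : MemLp f 2 κ := MemLp.of_bound hfm.aestronglyMeasurable 1 (ae_of_all _ fun x => by
    rw [Real.norm_of_nonneg (hmem x).1]; exact (hmem x).2)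
  set X : (Fin N → ℝ) → ℝ := ∑ i, fun U => f (U i) with hX
  have hXL2 : MemLp X 2 (Measure.pi fun _ : Fin N => κ) :=
    memLp_finsetSum' _ fun i _ => hL2.comp_measurePreserving (measurePreserving_eval _ i)
  have hcard : ∀ U, X U = ((Finset.univ.filter fun i => U i ∈ B).card : ℝ) := by
    intro U
    simp [hX, hf, Set.indicator_apply]
  have hint : ∫ U, X U ∂(Measure.pi fun _ : Fin N => κ) = N * κ.real B := by
    simp only [hX, Finset.sum_apply]
    rw [integral_finsetSum]
    · have : ∀ i : Fin N, ∫ U, f (U i) ∂(Measure.pi fun _ : Fin N => κ) = κ.real B := by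
        intro i
        rw [integral_comp_eval (μ := fun _ : Fin N => κ) (i := i) hfm.aestronglyMeasurable, hf,
          integral_indicator_one hB]
      simp [this]
    · intro i _
      exact (hL2.comp_measurePreserving (measurePreserving_eval (fun _ : Fin N => κ) i)).integrable
        (by norm_num)
  have hvar : Var[X; Measure.pi fun _ : Fin N => κ] ≤ N := by
    rw [hX, variance_sum_pi fun _ => hL2]
    have h1 : Var[f; κ] ≤ 1 := by
      refine (variance_le_sq_of_bounded (ae_of_all _ hmem) hfm.aemeasurable).trans ?_
      norm_num
    simpa using mul_le_mul_of_nonneg_left h1 hN'.le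
  have h := meas_ge_le_variance_div_sq hXL2 (c := N * r) (by positivity)
  rw [hint] at h
  simp only [hcard] at h
  rw [measureReal_def]
  refine (ENNReal.toReal_mono ENNReal.ofReal_ne_top h).trans ?_
  rw [ENNReal.toReal_ofReal (div_nonneg (variance_nonneg _ _) (by positivity)),
    div_le_div_iff₀ (by positivity) (by positivity)]
  have : (0 : ℝ) ≤ N * r ^ 2 := by positivity
  nlinarith

/-- The variance `v` in the exponent is only an upper bound, so degenerate noise is included. -/
theorem measureReal_norm_gaussian_le {d : ℕ} {Ω : Type*} [MeasurableSpace Ω] {P : Measure Ω}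
    [IsProbabilityMeasure P] {ζ : Ω → EuclideanSpace ℝ (Fin d)} {s v : ℝ} (hs : 0 ≤ s)
    (hsv : s ≤ v)
    (hζ : HasLaw ζ (multivariateGaussian 0 (s • (1 : Matrix (Fin d) (Fin d) ℝ))) P)
    {r : ℝ} (hr : 0 ≤ r) :
    P.real {ω | d * r < ‖ζ ω‖} ≤ 2 * d * Real.exp (-r ^ 2 / (2 * v)) := by
  have hpos : (s • (1 : Matrix (Fin d) (Fin d) ℝ)).PosSemidef := Matrix.PosSemidef.one.smul hs
  have hlaw : ∀ i, P.map (fun ω => ζ ω i) = gaussianReal 0 s.toNNReal := by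
    intro i
    have h1 := (measurePreserving_eval_multivariateGaussian (μ := 0) hpos (i := i))
    have h2 := h1.map_eq
    rw [← hζ.map_eq, AEMeasurable.map_map_of_aemeasurable h1.measurable.aemeasurable
      hζ.aemeasurable] at h2
    simpa [Function.comp_def] using h2
  have hmeas : ∀ i, AEMeasurable (fun ω => ζ ω i) P := fun i =>
    (measurePreserving_eval_multivariateGaussian (μ := 0) hpos
      (i := i)).measurable.comp_aemeasurable hζ.aemeasurable
  have hsub : ∀ i, HasSubgaussianMGF (fun ω => ζ ω i) v.toNNReal P := by
    intro i
    refine ⟨fun t => ?_, fun t => ?_⟩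
    · have := integrable_exp_mul_gaussianReal (μ := 0) (v := s.toNNReal) t
      rw [← hlaw i] at this
      exact this.comp_aemeasurable (hmeas i)
    · rw [mgf_gaussianReal (hlaw i)]
      rw [Real.coe_toNNReal _ hs, Real.coe_toNNReal _ (hs.trans hsv)]
      gcongr
      nlinarith [mul_le_mul_of_nonneg_right hsv (sq_nonneg t)]
  have hcov : {ω | d * r < ‖ζ ω‖} ⊆
      ⋃ i : Fin d, ({ω | r ≤ ζ ω i} ∪ {ω | r ≤ (-fun ω => ζ ω i) ω}) := by
    intro ω hω
    by_contra hcon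
    simp only [mem_iUnion, mem_union, mem_ofPred_eq, Pi.neg_apply, not_exists, not_or, not_le]
      at hcon
    have h1 : ‖ζ ω‖ ≤ ∑ i, ‖ζ ω i‖ := by
      rw [EuclideanSpace.norm_eq]
      refine Real.sqrt_le_iff.2 ⟨by positivity, ?_⟩
      exact Finset.sum_sq_le_sq_sum_of_nonneg fun i _ => norm_nonneg _
    have h2 : ∑ i, ‖ζ ω i‖ ≤ ∑ _i : Fin d, r := Finset.sum_le_sum fun i _ => by
      rw [Real.norm_eq_abs, abs_le]
      constructor <;> linarith [(hcon i).1, (hcon i).2]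
    simp only [Finset.sum_const, Finset.card_univ, Fintype.card_fin, nsmul_eq_mul] at h2
    exact absurd hω (not_lt.2 (h1.trans h2))
  refine (measureReal_mono hcov).trans ((measureReal_iUnion_fintype_le _).trans ?_)
  have hone : ∀ i : Fin d, P.real ({ω | r ≤ ζ ω i} ∪ {ω | r ≤ (-fun ω => ζ ω i) ω})
      ≤ 2 * Real.exp (-r ^ 2 / (2 * v)) := by
    intro i
    have h1 := (hsub i).measure_ge_le hr
    have h2 := (hsub i).neg.measure_ge_le hr
    rw [Real.coe_toNNReal _ (hs.trans hsv)] at h1 h2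
    linarith [measureReal_union_le (μ := P) {ω | r ≤ ζ ω i} {ω | r ≤ (-fun ω => ζ ω i) ω}]
  refine (Finset.sum_le_sum fun i _ => hone i).trans (le_of_eq ?_)
  simp
  ring

/-! ### Gaps between uniform order statistics -/

/-- The value `v` at position `j` comes before the value `u` at position `i` when a sample is
sorted with ties broken by the position. -/
def Precedes {N : ℕ} (i j : Fin N) (u v : ℝ) : Prop := v < u ∨ (v = u ∧ j < i)

theorem measurableSet_precedes {N : ℕ} (i j : Fin N) {β : Type*} [MeasurableSpace β]
    {f g : β → ℝ} (hf : Measurable f) (hg : Measurable g) :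
    MeasurableSet {x | Precedes i j (f x) (g x)} :=
  (measurableSet_lt hg hf).union ((measurableSet_eq_fun hg hf).inter (MeasurableSet.const _))

open scoped Classical in
/-- The positions of the sample points that come before the `i`-th one in the sorted sample. The
positions other than `i` are enumerated by `Fin n` through `Fin.succAbove i`. -/
noncomputable def below {n : ℕ} (U : Fin (n + 1) → ℝ) (i : Fin (n + 1)) : Finset (Fin n) :=
  Finset.univ.filter fun j => Precedes i (i.succAbove j) (U i) (U (i.succAbove j))

open scoped Classical in
/-- The number of sample points in the interval `(U i, U i + s]`. -/
noncomputable def gapCount {n : ℕ} (s : ℝ) (U : Fin (n + 1) → ℝ) (i : Fin (n + 1)) : ℕ :=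
  (Finset.univ.filter fun j => U (i.succAbove j) ∈ Ioc (U i) (U i + s)).card

/-- The positions in the sorted sample are a bijection, because ties are broken. -/
theorem bijective_card_below {n : ℕ} (U : Fin (n + 1) → ℝ) :
    Function.Bijective fun i : Fin (n + 1) =>
      (⟨(below U i).card, Nat.lt_succ_of_le ((Finset.card_le_univ _).trans (by simp))⟩ :
        Fin (n + 1)) := by
  classical
  have hcard : ∀ i, (below U i).card
      = (Finset.univ.filter fun j => Precedes i j (U i) (U j)).card := by
    intro i
    rw [below, Finset.card_filter, Finset.card_filter, Fin.sum_univ_succAbove _ i, if_neg]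
    · simp
    · simp [Precedes]
  have hlt : ∀ i i' : Fin (n + 1), Precedes i' i (U i') (U i) →
      (below U i).card < (below U i').card := by
    intro i i' h
    rw [hcard, hcard]
    refine Finset.card_lt_card (Finset.ssubset_iff_of_subset (fun j => ?_) |>.2 ⟨i, ?_, ?_⟩)
    · simp only [Finset.mem_filter, Finset.mem_univ, true_and]
      simp only [Precedes] at h ⊢
      grind
    · simpa using h
    · rw [Finset.mem_filter]
      simp [Precedes]
  refine Finite.injective_iff_bijective.1 fun i i' h => ?_
  simp only [Fin.mk.injEq] at h
  by_contra hne
  rcases lt_trichotomy (U i) (U i') with h1 | h1 | h1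
  · exact (hlt i i' (Or.inl h1)).ne h
  · rcases lt_or_gt_of_ne hne with h2 | h2
    · exact (hlt i i' (Or.inr ⟨h1, h2⟩)).ne h
    · exact (hlt i' i (Or.inr ⟨h1.symm, h2⟩)).ne h.symm
  · exact (hlt i' i (Or.inl h1)).ne h.symm

/-- Conditionally on the `i`-th coordinate, the other ones remain independent. -/
theorem lintegral_prod_succAbove {n : ℕ} (κ : Measure ℝ) [IsProbabilityMeasure κ]
    (i : Fin (n + 1)) {g : Fin n → ℝ → ℝ → ENNReal}
    (hg : ∀ j, Measurable (Function.uncurry (g j))) :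
    ∫⁻ U, ∏ j, g j (U i) (U (i.succAbove j)) ∂(Measure.pi fun _ : Fin (n + 1) => κ)
      = ∫⁻ u, ∏ j, ∫⁻ v, g j u v ∂κ ∂κ := by
  have h1 := measurePreserving_piFinSuccAbove (fun _ : Fin (n + 1) => κ) i
  have hm : Measurable fun p : ℝ × (Fin n → ℝ) => ∏ j, g j p.1 (p.2 j) :=
    Finset.measurable_prod _ fun j _ => (hg j).comp
      (measurable_fst.prodMk ((measurable_pi_apply j).comp measurable_snd))
  have h2 := h1.lintegral_comp hm
  have h3 : ∀ U : Fin (n + 1) → ℝ, ∏ j, g j (U i) (U (i.succAbove j))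
      = (fun p : ℝ × (Fin n → ℝ) => ∏ j, g j p.1 (p.2 j))
        (MeasurableEquiv.piFinSuccAbove (fun _ => ℝ) i U) := fun U => rfl
  simp_rw [h3]
  rw [h2, lintegral_prod _ hm.aemeasurable]
  refine lintegral_congr fun u => ?_
  have hgu : ∀ j, Measurable (g j u) := fun j => (hg j).comp measurable_prodMk_left
  have hind : iIndepFun (fun (j : Fin n) (V : Fin n → ℝ) => g j u (V j))
      (Measure.pi fun _ : Fin n => κ) :=
    iIndepFun_pi (μ := fun _ : Fin n => κ) (X := fun j => g j u) fun j => (hgu j).aemeasurable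
  simp only
  rw [lintegral_prod_eq_prod_lintegral_of_indepFun Finset.univ _ hind
    fun j => (hgu j).comp (measurable_pi_apply j)]
  refine Finset.prod_congr rfl fun j _ => ?_
  exact (measurePreserving_eval (fun _ : Fin n => κ) j).lintegral_comp (hgu j)

/-- Of the mass to the right of `u`, at least the fraction `s` lies in `(u, u + s]`, where the
integrand is `1 / 2`. -/
theorem lintegral_indicator_gap_le {u s : ℝ} (hu : u ∈ Ioo (0 : ℝ) 1) (hs : s ∈ Icc (0 : ℝ) 1)
    {W : Set ℝ} (hW : MeasurableSet W) (hWu : Ioi u ⊆ W) (huW : W ⊆ Ici u)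
    [∀ v, Decidable (v ∈ Ioc u (u + s))] :
    ∫⁻ v, W.indicator (fun v => if v ∈ Ioc u (u + s) then (2 : ENNReal)⁻¹ else 1) v ∂unif
      ≤ ENNReal.ofReal (Real.exp (-(s / 2))) * unif W := by
  have hWm : unif W = ENNReal.ofReal (1 - u) := by
    rw [← unif_Ioi hu.1.le]
    refine le_antisymm ?_ (measure_mono hWu)
    rw [measure_congr (Ioi_ae_eq_Ici : Ioi u =ᵐ[unif] Ici u)]
    exact measure_mono huW
  generalize hB : Ioc u (u + s) = B at *
  have hBW : B ⊆ W := fun x hx => hWu (by rw [← hB] at hx; exact hx.1)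
  have hBmeas : MeasurableSet B := hB ▸ measurableSet_Ioc
  have hBm : ENNReal.ofReal (s * (1 - u)) ≤ unif B := by
    rw [← hB]
    refine le_trans ?_ (measure_mono (Ioc_subset_Ioc_right (min_le_left (u + s) 1)))
    rw [unif_Ioc hu.1.le (min_le_right _ _)]
    refine ENNReal.ofReal_le_ofReal ?_
    rcases min_cases (u + s) 1 with ⟨h, _⟩ | ⟨h, _⟩ <;> rw [h] <;>
      nlinarith [hu.1, hu.2, hs.1, hs.2]
  have hsplit : ∫⁻ v, W.indicator (fun v => if v ∈ B then (2 : ENNReal)⁻¹ else 1) v ∂unif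
      = unif (W \ B) + 2⁻¹ * unif B := by
    have : W.indicator (fun v => if v ∈ B then (2 : ENNReal)⁻¹ else 1)
        = fun v => (W \ B).indicator 1 v + B.indicator (fun _ => 2⁻¹) v := by
      ext v
      by_cases h1 : v ∈ B
      · simp [h1, hBW h1]
      · by_cases h2 : v ∈ W <;> simp [h1, h2]
    rw [this, lintegral_add_left (measurable_one.indicator (hW.diff hBmeas)),
      lintegral_indicator_one (hW.diff hBmeas),
      lintegral_indicator_const hBmeas]
  rw [hsplit, measure_sdiff hBW hBmeas.nullMeasurableSet (measure_ne_top _ _), hWm]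
  have hBr : unif B = ENNReal.ofReal (unif.real B) := (ofReal_measureReal).symm
  have h2 : (2 : ENNReal)⁻¹ = ENNReal.ofReal (1 / 2) := by
    rw [one_div, ENNReal.ofReal_inv_of_pos (by norm_num)]
    norm_num
  rw [hBr] at hBm ⊢
  rw [h2]
  have hb : s * (1 - u) ≤ unif.real B :=
    (ENNReal.ofReal_le_ofReal_iff measureReal_nonneg).1 hBm
  have hbW : unif.real B ≤ 1 - u := by
    have := measure_mono (μ := unif) hBW
    rw [hWm, hBr] at this
    exact (ENNReal.ofReal_le_ofReal_iff (by linarith [hu.2])).1 this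
  rw [← ENNReal.ofReal_sub _ measureReal_nonneg, ← ENNReal.ofReal_mul (by norm_num),
    ← ENNReal.ofReal_add (by linarith) (by positivity), ← ENNReal.ofReal_mul (by positivity)]
  refine ENNReal.ofReal_le_ofReal ?_
  have h3 : 1 - s / 2 ≤ Real.exp (-(s / 2)) := by linarith [Real.add_one_le_exp (-(s / 2))]
  have h4 := mul_le_mul_of_nonneg_right h3 (by linarith [hu.2] : (0 : ℝ) ≤ 1 - u)
  linarith

theorem measurableSet_below_eq {n : ℕ} (i : Fin (n + 1)) (S : Finset (Fin n)) :
    MeasurableSet {U : Fin (n + 1) → ℝ | below U i = S} := by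
  have : {U : Fin (n + 1) → ℝ | below U i = S}
      = ⋂ j, {U | Precedes i (i.succAbove j) (U i) (U (i.succAbove j)) ↔ j ∈ S} := by
    ext U
    simp [below, Finset.ext_iff]
  rw [this]
  refine MeasurableSet.iInter fun j => ?_
  have h := measurableSet_precedes i (i.succAbove j) (measurable_pi_apply (X := fun _ => ℝ) i)
    (measurable_pi_apply (i.succAbove j))
  by_cases hj : j ∈ S
  · simpa only [hj, iff_true] using h
  · simpa only [hj, iff_false] using! h.compl

/-- Chernoff's bound for the number of points right after the `i`-th one, given which of the
points come before it. -/
theorem measure_below_eq_inter_gapCount_lt_le {n : ℕ} (i : Fin (n + 1)) (S : Finset (Fin n))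
    {s : ℝ} (hs : s ∈ Icc (0 : ℝ) 1) (m : ℕ) :
    (Measure.pi fun _ : Fin (n + 1) => unif) {U | below U i = S ∧ gapCount s U i < m}
      ≤ ENNReal.ofReal (2 ^ m * Real.exp (-(s / 2)) ^ (n - S.card)) *
        (Measure.pi fun _ : Fin (n + 1) => unif) {U | below U i = S} := by
  classical
  set κ := Measure.pi fun _ : Fin (n + 1) => unif with hκ
  -- the `j`-th factor of the indicator of `below U i = S`, and the same with a factor `1 / 2`
  -- for every point that contributes to `gapCount`
  let g₀ : Fin n → ℝ → ℝ → ENNReal := fun j u v =>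
    if Precedes i (i.succAbove j) u v ↔ j ∈ S then 1 else 0
  let g : Fin n → ℝ → ℝ → ENNReal := fun j u v =>
    if Precedes i (i.succAbove j) u v ↔ j ∈ S then
      (if v ∈ Ioc u (u + s) then 2⁻¹ else 1) else 0
  have hP : ∀ j : Fin n,
      MeasurableSet {p : ℝ × ℝ | Precedes i (i.succAbove j) p.1 p.2 ↔ j ∈ S} := by
    intro j
    have h := measurableSet_precedes i (i.succAbove j) (measurable_fst (α := ℝ) (β := ℝ))
      measurable_snd
    by_cases hj : j ∈ S
    · simpa only [hj, iff_true] using h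
    · simpa only [hj, iff_false] using! h.compl
  have hI : MeasurableSet {p : ℝ × ℝ | p.2 ∈ Ioc p.1 (p.1 + s)} :=
    (measurableSet_lt measurable_fst measurable_snd).inter
      (measurableSet_le measurable_snd (measurable_fst.add_const s))
  have hg₀m : ∀ j, Measurable (Function.uncurry (g₀ j)) := fun j =>
    Measurable.ite (hP j) measurable_const measurable_const
  have hgm : ∀ j, Measurable (Function.uncurry (g j)) := fun j =>
    Measurable.ite (hP j) (Measurable.ite hI measurable_const measurable_const) measurable_const
  have hEiff : ∀ U : Fin (n + 1) → ℝ, below U i = S ↔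
      ∀ j, (Precedes i (i.succAbove j) (U i) (U (i.succAbove j)) ↔ j ∈ S) := by
    intro U
    simp [below, Finset.ext_iff]
  have hprod₀ : ∀ U : Fin (n + 1) → ℝ, ∏ j, g₀ j (U i) (U (i.succAbove j))
      = {U : Fin (n + 1) → ℝ | below U i = S}.indicator 1 U := by
    intro U
    by_cases hU : below U i = S
    · rw [Set.indicator_of_mem (by exact hU)]
      exact Finset.prod_eq_one fun j _ => if_pos ((hEiff U).1 hU j)
    · rw [Set.indicator_of_notMem (by exact hU)]
      rw [hEiff U] at hU
      push Not at hU
      obtain ⟨j, hj⟩ := hU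
      refine Finset.prod_eq_zero (Finset.mem_univ j) (if_neg ?_)
      grind
  have hprod : ∀ U : Fin (n + 1) → ℝ, below U i = S ∧ gapCount s U i < m →
      1 ≤ (2 : ENNReal) ^ m * ∏ j, g j (U i) (U (i.succAbove j)) := by
    intro U hU
    have h1 : ∏ j, g j (U i) (U (i.succAbove j)) = 2⁻¹ ^ gapCount s U i := by
      rw [gapCount, ← Finset.prod_const, Finset.prod_filter]
      exact Finset.prod_congr rfl fun j _ => if_pos ((hEiff U).1 hU.1 j)
    rw [h1, ← ENNReal.inv_pow, ← div_eq_mul_inv,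
      ENNReal.le_div_iff_mul_le (Or.inl (by simp)) (Or.inl (by simp)), one_mul]
    exact pow_le_pow_right₀ (by norm_num) hU.2.le
  have hmeas : Measurable fun U : Fin (n + 1) → ℝ =>
      (2 : ENNReal) ^ m * ∏ j, g j (U i) (U (i.succAbove j)) := by
    refine Measurable.const_mul (Finset.measurable_prod _ fun j _ => ?_) _
    have h : Measurable fun U : Fin (n + 1) → ℝ => (U i, U (i.succAbove j)) :=
      (measurable_pi_apply i).prodMk (measurable_pi_apply _)
    exact (hgm j).comp h
  have hfactor : ∀ u ∈ Ioo (0 : ℝ) 1, ∀ j, ∫⁻ v, g j u v ∂unif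
      ≤ (if j ∈ S then 1 else ENNReal.ofReal (Real.exp (-(s / 2)))) * ∫⁻ v, g₀ j u v ∂unif := by
    intro u hu j
    by_cases hj : j ∈ S
    · rw [if_pos hj, one_mul]
      refine lintegral_mono fun v => ?_
      simp only [g, g₀]
      split_ifs <;> simp
    · rw [if_neg hj]
      set W : Set ℝ := {v | ¬ Precedes i (i.succAbove j) u v} with hWdef
      have hW : MeasurableSet W :=
        (measurableSet_precedes i (i.succAbove j) measurable_const measurable_id).compl
      have hgW : ∀ v, g j u v
          = W.indicator (fun v => if v ∈ Ioc u (u + s) then (2 : ENNReal)⁻¹ else 1) v := by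
        intro v
        simp only [g, hj, iff_false, Set.indicator_apply, hWdef, mem_ofPred_eq]
      have hg₀W : ∀ v, g₀ j u v = W.indicator 1 v := by
        intro v
        simp only [g₀, hj, iff_false, Set.indicator_apply, hWdef, mem_ofPred_eq, Pi.one_apply]
      simp_rw [hgW, hg₀W]
      rw [lintegral_indicator_one hW]
      refine lintegral_indicator_gap_le hu hs hW (fun v hv => ?_) (fun v hv => ?_)
      · rw [mem_Ioi] at hv
        simp only [hWdef, mem_ofPred_eq, Precedes]
        grind
      · simp only [hWdef, mem_ofPred_eq, Precedes, not_or, not_lt] at hv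
        exact hv.1
  have hconst : ∏ j, (if j ∈ S then 1 else ENNReal.ofReal (Real.exp (-(s / 2))))
      = ENNReal.ofReal (Real.exp (-(s / 2)) ^ (n - S.card)) := by
    rw [Finset.prod_ite, Finset.prod_const_one, one_mul, Finset.prod_const,
      ← ENNReal.ofReal_pow (Real.exp_nonneg _)]
    congr 2
    rw [Finset.filter_not, Finset.filter_mem_eq_inter, Finset.univ_inter,
      Finset.card_univ_sdiff, Fintype.card_fin]
  have hE := measurableSet_below_eq i S
  calc κ {U | below U i = S ∧ gapCount s U i < m}
      ≤ ∫⁻ U, (2 : ENNReal) ^ m * ∏ j, g j (U i) (U (i.succAbove j)) ∂κ :=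
        meas_le_lintegral₀ hmeas.aemeasurable hprod
    _ = 2 ^ m * ∫⁻ u, ∏ j, ∫⁻ v, g j u v ∂unif ∂unif := by
        rw [lintegral_const_mul' _ _ (by simp), hκ, lintegral_prod_succAbove unif i hgm]
    _ ≤ 2 ^ m * ∫⁻ u, ENNReal.ofReal (Real.exp (-(s / 2)) ^ (n - S.card)) *
          ∏ j, ∫⁻ v, g₀ j u v ∂unif ∂unif := by
        gcongr 2 ^ m * ?_
        refine lintegral_mono_ae ?_
        filter_upwards [ae_restrict_mem measurableSet_Ioo] with u hu
        rw [← hconst, ← Finset.prod_mul_distrib]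
        exact Finset.prod_le_prod' fun j _ => hfactor u hu j
    _ = ENNReal.ofReal (2 ^ m * Real.exp (-(s / 2)) ^ (n - S.card)) * κ {U | below U i = S} := by
        rw [lintegral_const_mul' _ _ ENNReal.ofReal_ne_top, ← lintegral_prod_succAbove unif i hg₀m]
        simp_rw [hprod₀]
        rw [lintegral_indicator_one hE, ← mul_assoc, ENNReal.ofReal_mul (by positivity),
          ENNReal.ofReal_pow (by norm_num : (0 : ℝ) ≤ 2)]
        norm_num [hκ]

/-- The events "`i` has rank `p + 1` and `S` is the set of points before it" are disjoint, so that
the conditional Chernoff bounds add up to an unconditional one. -/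
theorem measure_gapCount_lt_le {n p : ℕ} {s : ℝ} (hs : s ∈ Icc (0 : ℝ) 1) (m : ℕ) :
    (Measure.pi fun _ : Fin (n + 1) => unif)
      {U | ∃ i, (below U i).card = p ∧ gapCount s U i < m}
      ≤ ENNReal.ofReal (2 ^ m * Real.exp (-(s / 2)) ^ (n - p)) := by
  set κ := Measure.pi fun _ : Fin (n + 1) => unif with hκ
  set T : Finset (Fin (n + 1) × Finset (Fin n)) :=
    Finset.univ ×ˢ Finset.powersetCard p Finset.univ with hT
  have hdisj : (T : Set (Fin (n + 1) × Finset (Fin n))).PairwiseDisjoint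
      fun q => {U : Fin (n + 1) → ℝ | below U q.1 = q.2} := by
    intro q hq q' hq' hne
    refine Set.disjoint_left.2 fun U (h1 : below U q.1 = q.2) (h2 : below U q'.1 = q'.2) => hne ?_
    simp only [hT, Finset.coe_product, mem_prod, Finset.mem_coe, Finset.mem_univ, true_and,
      Finset.mem_powersetCard, Finset.subset_univ] at hq hq'
    have h3 : q.1 = q'.1 := (bijective_card_below U).1 (by simp [h1, h2, hq, hq'])
    exact Prod.ext h3 (by rw [← h1, ← h2, h3])
  calc κ {U | ∃ i, (below U i).card = p ∧ gapCount s U i < m}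
      ≤ κ (⋃ q ∈ T, {U | below U q.1 = q.2 ∧ gapCount s U q.1 < m}) := by
        refine measure_mono fun U => ?_
        rintro ⟨i, h1, h2⟩
        simp only [mem_iUnion]
        exact ⟨(i, below U i), by simp [hT, h1], rfl, h2⟩
    _ ≤ ∑ q ∈ T, κ {U | below U q.1 = q.2 ∧ gapCount s U q.1 < m} :=
        measure_biUnion_finset_le _ _
    _ ≤ ∑ q ∈ T, ENNReal.ofReal (2 ^ m * Real.exp (-(s / 2)) ^ (n - p)) *
          κ {U | below U q.1 = q.2} := by
        refine Finset.sum_le_sum fun q hq => ?_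
        have hc : q.2.card = p := by simpa [hT] using hq
        rw [← hc]
        exact measure_below_eq_inter_gapCount_lt_le q.1 q.2 hs m
    _ = ENNReal.ofReal (2 ^ m * Real.exp (-(s / 2)) ^ (n - p)) *
          κ (⋃ q ∈ T, {U | below U q.1 = q.2}) := by
        rw [← Finset.mul_sum,
          measure_biUnion_finset hdisj fun q _ => measurableSet_below_eq q.1 q.2]
    _ ≤ _ := mul_le_of_le_one_right' prob_le_one

/-! ### Gaps between order statistics of a general sample -/

theorem card_below_le_card_filter {n : ℕ} (U : Fin (n + 1) → ℝ) (i : Fin (n + 1)) (B : Set ℝ)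
    [DecidablePred (· ∈ B)]
    (hB : ∀ v ≤ U i, v ∈ B) : (below U i).card + 1 ≤
      (Finset.univ.filter fun j => U j ∈ B).card := by
  classical
  rw [below, Finset.card_filter, Finset.card_filter, Fin.sum_univ_succAbove _ i,
    if_pos (hB _ le_rfl), add_comm]
  gcongr with j
  split_ifs with h1 h2
  · exact le_rfl
  · exact absurd (hB _ (h1.elim le_of_lt fun h => h.1.le)) h2
  · exact Nat.zero_le _
  · exact le_rfl

theorem card_filter_le_card_below {n : ℕ} (U : Fin (n + 1) → ℝ) (i : Fin (n + 1)) (B : Set ℝ)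
    [DecidablePred (· ∈ B)] (hB : ∀ v ∈ B, v < U i) :
    (Finset.univ.filter fun j => U j ∈ B).card ≤ (below U i).card := by
  classical
  rw [below, Finset.card_filter, Finset.card_filter, Fin.sum_univ_succAbove _ i,
    if_neg (fun h => lt_irrefl _ (hB _ h)), zero_add]
  gcongr with j
  split_ifs with h1 h2
  · exact le_rfl
  · exact absurd (Or.inl (hB _ h1)) h2
  · exact Nat.zero_le _
  · exact le_rfl

theorem card_below_add_gapCount_le {n : ℕ} {s : ℝ} (hs : 0 ≤ s) (U : Fin (n + 1) → ℝ)
    (i : Fin (n + 1)) : (below U i).card + 1 + gapCount s U i ≤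
      (Finset.univ.filter fun j => U j ≤ U i + s).card := by
  classical
  rw [below, gapCount, Finset.card_filter, Finset.card_filter, Finset.card_filter,
    Fin.sum_univ_succAbove _ i, if_pos (by linarith), add_right_comm, add_comm _ 1,
    ← Finset.sum_add_distrib]
  gcongr with j
  simp only [Precedes, mem_Ioc]
  split_ifs <;> first | omega | grind

/-- A gap of `m` between order statistics of an i.i.d. sample is at most the modulus of continuity
of the quantile function, unless the corresponding gap of a uniform sample is wide or located
outside `[a, b]`. -/
theorem iid_orderStat_gap_le (ν : Measure ℝ) [IsProbabilityMeasure ν] {n k m : ℕ}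
    {a b s c : ℝ} (hk : 0 < k) (hkm : k + m ≤ n + 1) (ha : 0 < a) (hs : s ∈ Icc (0 : ℝ) 1)
    (hb : b + s < 1)
    (hG : ∀ u ∈ Icc a b, quantile (cdf ν) (u + s) - quantile (cdf ν) u ≤ c) :
    (Measure.pi fun _ : Fin (n + 1) => ν).real {R | c < orderStat R (k + m) - orderStat R k}
      ≤ 2 ^ m * Real.exp (-(s / 2)) ^ (n + 1 - k)
        + (Measure.pi fun _ : Fin (n + 1) => unif).real
          {U | k ≤ (Finset.univ.filter fun j => U j ∈ Iio a).card}
        + (Measure.pi fun _ : Fin (n + 1) => unif).real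
          {U | (Finset.univ.filter fun j => U j ∈ Iic b).card < k} := by
  set G := quantile (cdf ν)
  set κ := Measure.pi fun _ : Fin (n + 1) => unif with hκ
  have hGm := aemeasurable_quantile_cdf ν
  have hmap : (Measure.pi fun _ : Fin (n + 1) => ν) = κ.map fun U i => G (U i) := by
    have hsf : ∀ _ : Fin (n + 1), SigmaFinite (unif.map G) := fun _ => by
      rw [map_quantile_cdf_unif ν]
      infer_instance
    rw [hκ, Measure.pi_map_pi (hμ := hsf) fun _ => hGm, map_quantile_cdf_unif ν]
  have hGpi : AEMeasurable (fun (U : Fin (n + 1) → ℝ) i => G (U i)) κ :=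
    aemeasurable_pi_lambda _ fun i =>
      hGm.comp_quasiMeasurePreserving (Measure.quasiMeasurePreserving_eval _ i)
  have hA : MeasurableSet {R : Fin (n + 1) → ℝ | c < orderStat R (k + m) - orderStat R k} :=
    measurableSet_lt measurable_const ((measurable_orderStat _).sub (measurable_orderStat _))
  have hIoo : ∀ᵐ U ∂κ, ∀ i, U i ∈ Ioo (0 : ℝ) 1 := by
    rw [ae_all_iff]
    intro i
    exact (Measure.quasiMeasurePreserving_eval (fun _ : Fin (n + 1) => unif) i).ae
      (ae_restrict_mem measurableSet_Ioo)
  set E₁ : Set (Fin (n + 1) → ℝ) := {U | ∃ i, (below U i).card = k - 1 ∧ gapCount s U i < m}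
  set E₂ : Set (Fin (n + 1) → ℝ) := {U | k ≤ (Finset.univ.filter fun j => U j ∈ Iio a).card}
  set E₃ : Set (Fin (n + 1) → ℝ) := {U | (Finset.univ.filter fun j => U j ∈ Iic b).card < k}
  have hcov : (fun (U : Fin (n + 1) → ℝ) i => G (U i)) ⁻¹'
      {R | c < orderStat R (k + m) - orderStat R k} ≤ᵐ[κ] (E₁ ∪ E₂ ∪ E₃ : Set _) := by
    filter_upwards [hIoo] with U hU hc
    have hc' : c < orderStat (fun i => G (U i)) (k + m) - orderStat (fun i => G (U i)) k := hc
    by_contra hcon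
    change ¬ U ∈ E₁ ∪ E₂ ∪ E₃ at hcon
    simp only [mem_union, not_or, E₁, E₂, E₃, mem_ofPred_eq, not_exists, not_and, not_lt,
      not_le] at hcon
    obtain ⟨⟨h1, h2⟩, h3⟩ := hcon
    obtain ⟨i, hi⟩ := (bijective_card_below U).2 ⟨k - 1, by omega⟩
    simp only [Fin.mk.injEq] at hi
    have hgap := h1 i hi
    have hua : a ≤ U i := by
      by_contra! hlt
      have := card_below_le_card_filter U i (Iio a) fun v hv => lt_of_le_of_lt hv hlt
      omega
    have hub : U i ≤ b := by
      by_contra! hlt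
      have := card_filter_le_card_below U i (Iic b) fun v hv => lt_of_le_of_lt hv hlt
      omega
    have hus : U i + s ∈ Ioo (0 : ℝ) 1 := ⟨by linarith [hs.1], by linarith⟩
    have hlow : G (U i) ≤ orderStat (fun i => G (U i)) k := by
      refine le_orderStat_of_card_lt _ (by omega) ?_
      have h4 := card_filter_le_card_below U i (Iio (U i)) fun v hv => hv
      refine lt_of_le_of_lt (le_trans (Finset.card_le_card fun j => ?_) h4) (by omega)
      simp only [Finset.mem_filter, Finset.mem_univ, true_and, mem_Iio]
      intro hj
      by_contra! hle
      exact absurd (monotoneOn_quantile_cdf ν (hU i) (hU j) hle) (not_le.2 hj)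
    have hup : orderStat (fun i => G (U i)) (k + m) ≤ G (U i + s) := by
      rw [orderStat_le_iff _ (by omega) hkm]
      have h4 := card_below_add_gapCount_le hs.1 U i
      refine le_trans (le_trans (by omega) h4) (Finset.card_le_card fun j => ?_)
      simp only [Finset.mem_filter, Finset.mem_univ, true_and]
      exact fun hj => monotoneOn_quantile_cdf ν (hU j) hus hj
    linarith [hG (U i) ⟨hua, hub⟩]
  have hE₁ : κ.real E₁ ≤ 2 ^ m * Real.exp (-(s / 2)) ^ (n + 1 - k) := by
    have h := measure_gapCount_lt_le (n := n) (p := k - 1) hs m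
    rw [show n - (k - 1) = n + 1 - k by omega] at h
    exact ENNReal.toReal_le_of_le_ofReal (by positivity) h
  rw [measureReal_def, hmap, Measure.map_apply_of_aemeasurable hGpi hA]
  have h1 : κ.real ((fun (U : Fin (n + 1) → ℝ) i => G (U i)) ⁻¹'
      {R | c < orderStat R (k + m) - orderStat R k}) ≤ κ.real (E₁ ∪ E₂ ∪ E₃) :=
    ENNReal.toReal_mono (measure_ne_top _ _) (measure_mono_ae hcov)
  have h2 := measureReal_union_le (μ := κ) (E₁ ∪ E₂) E₃
  have h3 := measureReal_union_le (μ := κ) E₁ E₂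
  rw [measureReal_def] at h1
  linarith

theorem unif_real_Iic {a : ℝ} (ha : a ∈ Icc (0 : ℝ) 1) : unif.real (Iic a) = a := by
  rw [measureReal_def, unif_Iic ha.2, ENNReal.toReal_ofReal ha.1]

/-- Lower deviations: the `k`-th order statistic of a uniform sample is rarely below `k / N - r`. -/
theorem measureReal_le_card_Iio_le {N k : ℕ} (hN : 0 < N) {a r : ℝ} (ha : a ∈ Icc (0 : ℝ) 1)
    (hr : 0 < r) (hk : N * (a + r) ≤ k) :
    (Measure.pi fun _ : Fin N => unif).real
      {U | k ≤ (Finset.univ.filter fun j => U j ∈ Iio a).card} ≤ 1 / (N * r ^ 2) := by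
  refine (measureReal_mono fun U (hU : k ≤ _) => ?_).trans
    (measureReal_card_filter_le hN unif (measurableSet_Iio (a := a)) hr)
  have h1 : unif.real (Iio a) = a := by
    rw [measureReal_congr Iio_ae_eq_Iic, unif_real_Iic ha]
  have h2 : (k : ℝ) ≤ (Finset.univ.filter fun j => U j ∈ Iio a).card := by exact_mod_cast hU
  rw [mem_ofPred_eq, h1]
  refine le_trans ?_ (le_abs_self _)
  linarith

/-- Upper deviations: the `k`-th order statistic of a uniform sample is rarely above `k / N + r`. -/
theorem measureReal_card_Iic_lt_le {N k : ℕ} (hN : 0 < N) {b r : ℝ} (hb : b ∈ Icc (0 : ℝ) 1)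
    (hr : 0 < r) (hk : k ≤ N * (b - r)) :
    (Measure.pi fun _ : Fin N => unif).real
      {U | (Finset.univ.filter fun j => U j ∈ Iic b).card < k} ≤ 1 / (N * r ^ 2) := by
  refine (measureReal_mono fun U (hU : _ < k) => ?_).trans
    (measureReal_card_filter_le hN unif (measurableSet_Iic (a := b)) hr)
  have h2 : ((Finset.univ.filter fun j => U j ∈ Iic b).card : ℝ) ≤ k := by exact_mod_cast hU.le
  rw [mem_ofPred_eq, unif_real_Iic hb]
  refine le_trans ?_ (neg_le_abs _)
  linarith

/-! ### Choice of the gap and asymptotics -/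

theorem le_rank (β : ℝ) (n : ℕ) : (1 - β) * ((n : ℝ) + 1) ≤ rank β n := Nat.le_ceil _

theorem rank_lt_add_one {β : ℝ} (hβ : β ≤ 1) (n : ℕ) :
    (rank β n : ℝ) < (1 - β) * ((n : ℝ) + 1) + 1 :=
  Nat.ceil_lt_add_one (mul_nonneg (by linarith) (by positivity))

theorem adjLevel_le {α ε δ : ℝ} (hα : 0 ≤ α) (hε : 0 ≤ ε) (hδ : 0 ≤ δ) :
    adjLevel α ε δ ≤ α := by
  unfold adjLevel
  have h1 : Real.exp (-ε) ≤ 1 := Real.exp_le_one_iff.2 (by linarith)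
  have h2 := Real.exp_pos (-ε)
  nlinarith

theorem le_adjLevel {α ε δ : ℝ} (hα : α ≤ 1) (hε : 0 ≤ ε) (hδ : 0 ≤ δ) (hδα : δ ≤ α) :
    α - δ - ε ≤ adjLevel α ε δ := by
  unfold adjLevel
  have h1 : 1 - ε ≤ Real.exp (-ε) := by linarith [Real.add_one_le_exp (-ε)]
  have h2 := mul_le_mul_of_nonneg_right h1 (by linarith : 0 ≤ α - δ)
  nlinarith

/-- The privacy adjustment moves the rank by `O(ε n)`. -/
theorem rank_adjLevel_add_one_le {α ε δ D : ℝ} {n m : ℕ} (hn : 0 < n) (hα : α ∈ Ioo (0 : ℝ) 1)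
    (hε : 0 ≤ ε) (hδ : 0 ≤ δ) (hδα : δ ≤ α) (hD : 0 ≤ D) (hδD : δ ≤ D / n) (hεn : 1 ≤ ε * n)
    (hm : (4 + 2 * D) * (ε * n) ≤ m) : rank (adjLevel α ε δ) n + 1 ≤ rank α n + m := by
  have hn1 : (1 : ℝ) ≤ n := by exact_mod_cast hn
  have h1 := le_adjLevel hα.2.le hε hδ hδα
  have h2 := rank_lt_add_one ((adjLevel_le hα.1.le hε hδ).trans hα.2.le) n
  have h3 := le_rank α n
  have h4 : δ * n ≤ D := by rwa [le_div_iff₀ (by linarith)] at hδD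
  have h5 : (rank (adjLevel α ε δ) n : ℝ) + 1 ≤ rank α n + m := by
    have h6 : (1 - adjLevel α ε δ) * ((n : ℝ) + 1) ≤ (1 - (α - δ - ε)) * ((n : ℝ) + 1) :=
      mul_le_mul_of_nonneg_right (by linarith) (by positivity)
    nlinarith
  exact_mod_cast h5

/-- A gap of `m` order statistics near the level `1 - α` covers at most a fraction `8 m / (α N)`
of the distribution, with high probability. -/
theorem iid_orderStat_gap_near_level_le (ν : Measure ℝ) [IsProbabilityMeasure ν] {n m : ℕ}
    {α ϵ₀ c s : ℝ} (hα : α ∈ Ioo (0 : ℝ) 1) (hϵ₀ : 0 < ϵ₀) (hlo : 0 < 1 - α - ϵ₀)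
    (hhi : 1 - α + ϵ₀ < 1) (hαn : 2 ≤ α * ((n : ℝ) + 1)) (hϵ₀n : 4 ≤ ϵ₀ * ((n : ℝ) + 1))
    (hm : 0 < m) (hkm : rank α n + m ≤ n + 1) (hs : s = 8 / α * (m / ((n : ℝ) + 1)))
    (hsϵ : s ≤ ϵ₀ / 2)
    (hG : ∀ u ∈ Icc (1 - α - ϵ₀) (1 - α + ϵ₀ / 2),
      quantile (cdf ν) (u + s) - quantile (cdf ν) u ≤ c) :
    (Measure.pi fun _ : Fin (n + 1) => ν).real
        {R | c < orderStat R (rank α n + m) - orderStat R (rank α n)}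
      ≤ 1 / m + 17 / (((n : ℝ) + 1) * ϵ₀ ^ 2) := by
  have hN : (0 : ℝ) < (n : ℝ) + 1 := by positivity
  have hm' : (0 : ℝ) < m := by exact_mod_cast hm
  have hα0 := hα.1
  have hs0 : 0 ≤ s := by rw [hs]; positivity
  have hk1 := le_rank α n
  have hk2 := rank_lt_add_one hα.2.le n
  have hk0 : 0 < rank α n := by
    have : 0 < (1 - α) * ((n : ℝ) + 1) := mul_pos (by linarith [hα.2]) hN
    exact_mod_cast this.trans_le hk1
  have h := iid_orderStat_gap_le ν hk0 hkm hlo ⟨hs0, by linarith⟩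
    (b := 1 - α + ϵ₀ / 2) (by linarith) hG
  have h1 := measureReal_le_card_Iio_le (N := n + 1) (k := rank α n) (Nat.succ_pos n)
    (a := 1 - α - ϵ₀) (r := ϵ₀) ⟨hlo.le, by linarith⟩ hϵ₀ (by push_cast; linarith)
  have h2 := measureReal_card_Iic_lt_le (N := n + 1) (k := rank α n) (Nat.succ_pos n)
    (b := 1 - α + ϵ₀ / 2) (r := ϵ₀ / 4) ⟨by linarith, by linarith⟩ (by linarith)
    (by push_cast; nlinarith)
  -- at least half of the expected `α N` points lie beyond the rank, so that the exponent is
  -- at least `2 m`, against the factor `2 ^ m`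
  have h3 : (2 : ℝ) ^ m * Real.exp (-(s / 2)) ^ (n + 1 - rank α n) ≤ 1 / m := by
    have h4 : 2 * (m : ℝ) ≤ s / 2 * ((n + 1 - rank α n : ℕ) : ℝ) := by
      rw [Nat.cast_sub (by omega)]
      push_cast
      have h5 : α * ((n : ℝ) + 1) / 2 ≤ (n : ℝ) + 1 - rank α n := by linarith
      have h6 : s / 2 * (α * ((n : ℝ) + 1) / 2) = 2 * m := by
        rw [hs]
        field_simp
        norm_num
      rw [← h6]
      exact mul_le_mul_of_nonneg_left h5 (by linarith)
    have h7 : (2 : ℝ) ^ m ≤ Real.exp m := by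
      rw [← Real.exp_one_pow]
      exact pow_le_pow_left₀ (by norm_num) (by linarith [Real.add_one_le_exp (1 : ℝ)]) _
    rw [← Real.exp_nat_mul]
    calc (2 : ℝ) ^ m * Real.exp (((n + 1 - rank α n : ℕ) : ℝ) * -(s / 2))
        ≤ Real.exp m * Real.exp (-(2 * m)) := by
          gcongr
          linarith
      _ = (Real.exp m)⁻¹ := by rw [← Real.exp_add, ← Real.exp_neg]; congr 1; ring
      _ ≤ 1 / m := by
          rw [one_div]
          exact inv_anti₀ hm' (by linarith [Real.add_one_le_exp (m : ℝ)])
  have h8 : 1 / (((n : ℝ) + 1) * ϵ₀ ^ 2) + 1 / (((n : ℝ) + 1) * (ϵ₀ / 4) ^ 2)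
      = 17 / (((n : ℝ) + 1) * ϵ₀ ^ 2) := by
    field_simp
    norm_num
  push_cast at h1 h2
  linarith

/-- The noise has standard deviation `O(√(log n) / (ε n))`. -/
theorem noiseVar_sensitivity_le {ρ L : ℝ≥0} {lam ε δ K : ℝ} {n : ℕ} (hε : 0 < ε) (hn : 0 < n)
    (hlog : Real.log (1.25 / δ) ≤ K * Real.log n) :
    noiseVar (sensitivity ρ L lam n) ε δ
      ≤ 2 * K * (2 * ρ * L / lam) ^ 2 * Real.log n / (ε * n) ^ 2 := by
  have hn' : (0 : ℝ) < n := by exact_mod_cast hn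
  have h : noiseVar (sensitivity ρ L lam n) ε δ
      = 2 * (2 * ρ * L / lam) ^ 2 / (ε * n) ^ 2 * Real.log (1.25 / δ) := by
    rw [noiseVar, sensitivity, mul_pow, ← div_div]
    field_simp
  rw [h]
  refine (mul_le_mul_of_nonneg_left hlog (by positivity)).trans (le_of_eq ?_)
  ring

/-- The tail of the norm of the privacy noise at `O(t)`, with the exponent of the theorem. -/
theorem measureReal_norm_noise_le {d : ℕ} {Ω : Type*} [MeasurableSpace Ω] {P : Measure Ω}
    [IsProbabilityMeasure P] {ζ : Ω → EuclideanSpace ℝ (Fin d)} {s V ε t : ℝ} {n : ℕ}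
    (hs : 0 ≤ s) (hV : 0 < V) (hε : 0 < ε) (hn : 1 < n) (ht : 0 < t)
    (hsV : s ≤ V * Real.log n / (ε * n) ^ 2)
    (hζ : HasLaw ζ (multivariateGaussian 0 (s • (1 : Matrix (Fin d) (Fin d) ℝ))) P) :
    P.real {ω | d * (√(2 * V) * t) < ‖ζ ω‖}
      ≤ 2 * d * Real.exp (-(ε ^ 2 * (n : ℝ) ^ 2 * t ^ 2 / Real.log n)) := by
  have hn1 : (1 : ℝ) < n := by exact_mod_cast hn
  have hlog := Real.log_pos hn1
  have h := measureReal_norm_gaussian_le hs hsV hζ (r := √(2 * V) * t) (by positivity)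
  refine h.trans (le_of_eq ?_)
  congr 2
  rw [mul_pow, Real.sq_sqrt (by positivity)]
  field_simp

theorem log_div_le {δ K y : ℝ} (hδ : 0 < δ) (hy : 1 ≤ y) (h : Real.log (1 / δ) ≤ K * y) :
    Real.log (1.25 / δ) ≤ (K + 1) * y := by
  have h2 : Real.log (1.25 / δ) = Real.log 1.25 + Real.log (1 / δ) := by
    rw [← Real.log_mul (by norm_num) (one_div_ne_zero hδ.ne'), mul_one_div]
  have h3 : Real.log 1.25 ≤ 1 := by
    linarith [Real.log_le_sub_one_of_pos (by norm_num : (0 : ℝ) < 1.25)]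
  linarith

/-- A gap of `O(ε n)` ranks above the oracle rank stays within the sample for small `ε`. -/
theorem rank_add_le {α ε B : ℝ} {n m : ℕ} (hα : α ≤ 1) (hαn : 2 ≤ (n : ℝ) * α) (hα0 : 0 < α)
    (hε : ε * (B + 1) ≤ α / 2) (hm : (m : ℝ) ≤ (B + 1) * (ε * n)) :
    rank α n + m ≤ n + 1 := by
  have h1 := rank_lt_add_one hα n
  have h2 : (m : ℝ) ≤ α / 2 * n := by
    refine hm.trans ?_
    have := mul_le_mul_of_nonneg_right hε (Nat.cast_nonneg (α := ℝ) n)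
    linarith
  have h3 : (rank α n : ℝ) + m ≤ n + 1 := by linarith
  exact_mod_cast h3

/-- The gap of the oracle scores, for the choice of `m` and `s` in terms of `ε`, with the modulus
of continuity of the quantile function inserted. -/
theorem iid_orderStat_gap_le_of_holder (ν : Measure ℝ) [IsProbabilityMeasure ν] {n m : ℕ}
    {α γ h ϵ₀ ε B S : ℝ} (hα : α ∈ Ioo (0 : ℝ) 1) (hγ : 0 < γ) (hϵ₀ : 0 < ϵ₀)
    (hlo : 0 < 1 - α - ϵ₀) (hhi : 1 - α + ϵ₀ < 1) (hε : 0 < ε) (hε1 : ε ≤ 1) (hn : 0 < n)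
    (hαn : 2 ≤ (n : ℝ) * α) (hϵ₀n : 4 ≤ (n : ℝ) * ϵ₀) (hB : 0 ≤ B)
    (hS : S = 8 / α * (B + 1)) (hεϵ : ε * S ≤ ϵ₀ / 2) (hm : ε * n ≤ m)
    (hmB : (m : ℝ) ≤ (B + 1) * (ε * n)) (hkm : rank α n + m ≤ n + 1)
    (hquant : ∀ q₁ ∈ Icc (1 - α - ϵ₀) (1 - α + ϵ₀), ∀ q₂ ∈ Icc (1 - α - ϵ₀) (1 - α + ϵ₀),
      |quantile (cdf ν) q₁ - quantile (cdf ν) q₂| ≤ h * |q₁ - q₂| ^ γ) :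
    (Measure.pi fun _ : Fin (n + 1) => ν).real
        {R | |h| * S ^ γ * ε ^ γ < orderStat R (rank α n + m) - orderStat R (rank α n)}
      ≤ (1 + 17 / ϵ₀ ^ 2) * (1 / (ε * n)) := by
  have hα0 := hα.1
  have hn' : (0 : ℝ) < n := by exact_mod_cast hn
  have hx : 0 < ε * n := mul_pos hε hn'
  have hm0 : 0 < m := by exact_mod_cast hx.trans_le hm
  have hS0 : 0 < S := by rw [hS]; positivity
  set s : ℝ := 8 / α * (m / ((n : ℝ) + 1)) with hs
  have hsS : s ≤ S * ε := by
    rw [hs, hS, mul_assoc]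
    refine mul_le_mul_of_nonneg_left ?_ (by positivity)
    rw [div_le_iff₀ (by positivity)]
    have : 0 ≤ (B + 1) * ε := by positivity
    linarith
  have hs0 : 0 ≤ s := by positivity
  have hsϵ : s ≤ ϵ₀ / 2 := by linarith
  have hG : ∀ u ∈ Icc (1 - α - ϵ₀) (1 - α + ϵ₀ / 2),
      quantile (cdf ν) (u + s) - quantile (cdf ν) u ≤ |h| * S ^ γ * ε ^ γ := by
    intro u hu
    have h1 := hquant (u + s) ⟨by linarith [hu.1], by linarith [hu.2]⟩ u
      ⟨hu.1, by linarith [hu.2]⟩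
    rw [add_sub_cancel_left, abs_of_nonneg hs0] at h1
    have h2 : s ^ γ ≤ S ^ γ * ε ^ γ := by
      rw [← Real.mul_rpow hS0.le hε.le]
      exact Real.rpow_le_rpow hs0 hsS hγ.le
    calc _ ≤ h * s ^ γ := (le_abs_self _).trans h1
      _ ≤ |h| * s ^ γ := mul_le_mul_of_nonneg_right (le_abs_self h) (Real.rpow_nonneg hs0 _)
      _ ≤ |h| * (S ^ γ * ε ^ γ) := mul_le_mul_of_nonneg_left h2 (abs_nonneg h)
      _ = _ := by ring
  refine (iid_orderStat_gap_near_level_le ν hα hϵ₀ hlo hhi (by linarith) (by linarith) hm0 hkm hs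
    hsϵ hG).trans ?_
  have h1 : 1 / (m : ℝ) ≤ 1 / (ε * n) := one_div_le_one_div_of_le hx hm
  have h2 : 17 / (((n : ℝ) + 1) * ϵ₀ ^ 2) ≤ 17 / ϵ₀ ^ 2 * (1 / (ε * n)) := by
    rw [div_mul_div_comm, mul_one, mul_comm (ϵ₀ ^ 2)]
    gcongr
    have := mul_le_mul_of_nonneg_right hε1 hn'.le
    linarith
  rw [add_mul (1 : ℝ), one_mul]
  exact add_le_add h1 h2

/-- The deterministic bound off the two bad events. -/
theorem volume_symmDiff_intervals_le_of_good {𝒳 E : Type*} [NormedAddCommGroup E]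
    [NormedSpace ℝ E] {𝒴 : Set ℝ} {ℓ : 𝒴 → ℝ → ℝ} {μ : 𝒳 → E → ℝ} {reg : E → ℝ} {n : ℕ}
    (hn : 0 < n) {lam : ℝ} (hlam : 0 < lam) {ρ L : ℝ≥0} {D : Fin (n + 1) → 𝒳 × 𝒴}
    (hconv : StrongConvexOn univ lam (risk ℓ μ reg (initial D)))
    (hloss : ∀ x y, LipschitzWith (ρ * L) (fun ϑ => ℓ y (μ x ϑ)))
    (hmodel : ∀ x, LipschitzWith L (μ x)) {ϑ ϑ' z : E}
    (hϑ : IsMinOn (risk ℓ μ reg (initial D)) univ ϑ)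
    (hϑ' : IsMinOn (augRisk ℓ μ reg D) univ ϑ') {α α₁ e r c : ℝ} {m : ℕ}
    (h0 : 0 < rank α n) (h1 : rank α n ≤ rank α₁ n)
    (h3 : rank α₁ n + 1 ≤ rank α n + m) (h4 : rank α n + m ≤ n + 1) (he : 1 / (n : ℝ) ≤ e)
    (hz : ‖z‖ ≤ r)
    (hgap : orderStat (fun i => score μ (D i) ϑ') (rank α n + m)
      - orderStat (fun i => score μ (D i) ϑ') (rank α n) ≤ c) :
    volume.real (symmDiff (oracleInterval μ α D ϑ') (differentialInterval μ α₁ D (ϑ + z)))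
      ≤ 8 * ρ * L ^ 2 / lam * e + 4 * L * r + 2 * c := by
  have hn' : (0 : ℝ) < n := by exact_mod_cast hn
  have hvol := volume_symmDiff_intervals_le (D := D) hmodel (ϑ + z) ϑ' h0 h1 (by omega) h3 h4
  have hdist := dist_argmin_le_sensitivity hn hlam hconv hloss hϑ hϑ'
  have hsens : sensitivity ρ L lam n ≤ 2 * ρ * L / lam * e := by
    have : sensitivity ρ L lam n = 2 * ρ * L / lam * (1 / n) := by
      unfold sensitivity
      field_simp
    rw [this]
    exact mul_le_mul_of_nonneg_left he (by positivity)
  have hnorm : ‖ϑ + z - ϑ'‖ ≤ 2 * ρ * L / lam * e + r := by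
    rw [add_sub_right_comm]
    exact (norm_add_le _ _).trans (add_le_add (hdist.trans hsens) hz)
  have h5 : 4 * (L * ‖ϑ + z - ϑ'‖) ≤ 4 * (L * (2 * ρ * L / lam * e + r)) := by gcongr
  have h6 : 4 * (L * (2 * ρ * L / lam * e + r)) = 8 * ρ * L ^ 2 / lam * e + 4 * L * r := by ring
  linarith

end DPCP

theorem mainTheorem9
    -- fixed constants
    (d : ℕ) (α γ h ϵ₀ lam : ℝ) (ρ L : ℝ≥0)
    (hα : α ∈ Ioo (0 : ℝ) 1) (hγ : γ ∈ Ioc (0 : ℝ) 1) (hlam : 0 < lam)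
    (hϵ₀ : 0 < ϵ₀) (hϵ₀α : Icc (1 - α - ϵ₀) (1 - α + ϵ₀) ⊆ Ioo (0 : ℝ) 1)
    -- privacy parameters, as functions of the sample size
    (ε₁ δ : ℕ → ℝ)
    (hε₁ : Tendsto ε₁ atTop (𝓝 0))
    (hε₁n : Tendsto (fun n : ℕ => ε₁ n * (n : ℝ)) atTop atTop)
    (hδ_pos : ∀ n, 0 < δ n)
    (hδ : δ =O[atTop] fun n : ℕ => 1 / (n : ℝ))
    (hδ_log : (fun n : ℕ => Real.log (1 / δ n)) =O[atTop] fun n : ℕ => Real.log (n : ℝ)) :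
    ∃ C : ℝ, 0 < C ∧ ∀ᶠ n : ℕ in atTop,
      ∀ (𝒳 : Type*) [MeasurableSpace 𝒳] (𝒴 : Set ℝ)
        (Ω : Type*) [MeasurableSpace Ω] (P : Measure Ω) [IsProbabilityMeasure P]
        -- loss, model, regularizer
        (ℓ : 𝒴 → ℝ → ℝ) (μ : 𝒳 → EuclideanSpace ℝ (Fin d) → ℝ)
        (reg : EuclideanSpace ℝ (Fin d) → ℝ)
        -- data points (the last one is the test point), noise, and the two ERM estimators
        (Z : Fin (n + 1) → Ω → 𝒳 × 𝒴) (ζ : Ω → EuclideanSpace ℝ (Fin d))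
        (ϑn ϑn1 : Ω → EuclideanSpace ℝ (Fin d))
        -- idealized score law and approximation error
        (ν : Measure ℝ) [IsProbabilityMeasure ν] (ξTV : ℝ),
      (∀ D : Fin n → 𝒳 × 𝒴, StrongConvexOn univ lam (DPCP.risk ℓ μ reg D)) →
      (∀ x y, LipschitzWith (ρ * L) (fun ϑ => ℓ y (μ x ϑ))) →
      (∀ x, LipschitzWith L (μ x)) →
      (∀ i, Measurable (Z i)) → iIndepFun Z P → (∀ i j, IdentDistrib (Z i) (Z j) P P) →
      (∀ ω, IsMinOn (DPCP.risk ℓ μ reg (DPCP.initial fun i => Z i ω)) univ (ϑn ω)) →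
      (∀ ω, IsMinOn (DPCP.augRisk ℓ μ reg (fun i => Z i ω)) univ (ϑn1 ω)) →
      HasLaw ζ (multivariateGaussian 0
        (DPCP.noiseVar (DPCP.sensitivity ρ L lam n) (ε₁ n) (δ n) •
          (1 : Matrix (Fin d) (Fin d) ℝ))) P →
      IndepFun (fun ω i => Z i ω) ζ P →
      DPCP.IsApproxIID P
        (fun i ω => DPCP.score μ (DPCP.initial (fun j => Z j ω) i) (ϑn ω + ζ ω)) ν ξTV →
      DPCP.IsApproxIID P (fun i ω => DPCP.score μ (Z i ω) (ϑn1 ω)) ν ξTV →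
      (∀ q₁ ∈ Icc (1 - α - ϵ₀) (1 - α + ϵ₀), ∀ q₂ ∈ Icc (1 - α - ϵ₀) (1 - α + ϵ₀),
        |DPCP.quantile (cdf ν) q₁ - DPCP.quantile (cdf ν) q₂| ≤ h * |q₁ - q₂| ^ γ) →
      ∀ t : ℝ, 0 < t →
        P.real {ω | C * (ε₁ n ^ γ + t) <
            volume.real (symmDiff
              (DPCP.oracleInterval μ α (fun i => Z i ω) (ϑn1 ω))
              (DPCP.differentialInterval μ (DPCP.adjLevel α (ε₁ n) (δ n)) (fun i => Z i ω)
                (ϑn ω + ζ ω)))}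
          ≤ C * (Real.exp (-(ε₁ n ^ 2 * (n : ℝ) ^ 2 * t ^ 2 / Real.log n)) + 1 / (ε₁ n * n))
            + 2 * ξTV := by
  have hlo : 0 < 1 - α - ϵ₀ := (hϵ₀α (left_mem_Icc.2 (by linarith))).1
  have hhi : 1 - α + ϵ₀ < 1 := (hϵ₀α (right_mem_Icc.2 (by linarith))).2
  obtain ⟨hα0, hα1⟩ := id hα
  obtain ⟨D, hD, hδD⟩ := hδ.exists_pos
  obtain ⟨K, hK, hδK⟩ := hδ_log.exists_pos
  rw [IsBigOWith_def] at hδD hδK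
  -- the rank gap is `m = ⌈B ε₁ n⌉`, of uniform length at most `S ε₁`
  set B : ℝ := 4 + 2 * D with hB
  set S : ℝ := 8 / α * (B + 1) with hS
  have hS0 : 0 < S := by positivity
  set V : ℝ := 2 * (K + 1) * (2 * ρ * L / lam) ^ 2 + 1 with hV
  have hV0 : 0 < V := by positivity
  set C₁ : ℝ := 8 * ρ * L ^ 2 / lam + 2 * (|h| * S ^ γ) with hC₁
  set C₂ : ℝ := 4 * L * (d * √(2 * V)) with hC₂
  set C₃ : ℝ := 1 + 17 / ϵ₀ ^ 2 with hC₃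
  have hC₁0 : 0 ≤ C₁ := by positivity
  have hC₂0 : 0 ≤ C₂ := by positivity
  have hC₃0 : 0 < C₃ := by positivity
  set C : ℝ := C₁ + C₂ + C₃ + 2 * d with hC
  have hn_top : Tendsto (fun n : ℕ => (n : ℝ)) atTop atTop := tendsto_natCast_atTop_atTop
  have hsmall : ∀ c : ℝ, 0 < c → ∀ᶠ n in atTop, ε₁ n ≤ c := fun c hc =>
    (hε₁.eventually (gt_mem_nhds hc)).mono fun _ => le_of_lt
  refine ⟨C, by positivity, ?_⟩
  filter_upwards [hδD, hδK, eventually_ge_atTop 3, hε₁n.eventually_ge_atTop 1,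
    hsmall 1 one_pos, hsmall (α / 2 / (B + 1)) (by positivity), hsmall (ϵ₀ / 2 / S) (by positivity),
    hn_top.eventually_ge_atTop (2 / α), hn_top.eventually_ge_atTop (4 / ϵ₀),
    hn_top.eventually_ge_atTop (D / α)]
    with n hδD hδK hn3 hx hε1 hεα hεϵ hnα hnϵ hnD
  intro 𝒳 _ 𝒴 Ω _ P _ ℓ μ reg Z ζ ϑn ϑn1 ν _ ξTV hconv hloss hmodel _ _ _ hϑn hϑn1 hζ _ _ hR1
    hquant t ht
  have hn0 : 0 < n := by omega
  have hn : (0 : ℝ) < n := by exact_mod_cast hn0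
  set x : ℝ := ε₁ n * n with hxdef
  have hε0 : 0 < ε₁ n := by
    by_contra! hle
    have := mul_nonpos_of_nonpos_of_nonneg hle hn.le
    linarith
  rw [div_le_iff₀ (by positivity)] at hnα hnϵ hnD
  rw [le_div_iff₀ (by positivity)] at hεα hεϵ
  have hδD' : δ n ≤ D / n := by
    have := (le_abs_self _).trans hδD
    rw [Real.norm_of_nonneg (by positivity)] at this
    rwa [mul_one_div] at this
  have hδα : δ n ≤ α := hδD'.trans (by rw [div_le_iff₀ hn]; linarith)
  have hδ1 : δ n ≤ 1 := hδα.trans hα1.le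
  -- the tail bound needs a nonnegative nominal variance, which holds as `δ ≤ 1`
  have hlogn : 1 ≤ Real.log n := by
    rw [Real.le_log_iff_exp_le hn]
    have : (3 : ℝ) ≤ n := by exact_mod_cast hn3
    linarith [Real.exp_one_lt_d9]
  have hlog : Real.log (1.25 / δ n) ≤ (K + 1) * Real.log n := by
    refine DPCP.log_div_le (hδ_pos n) hlogn ((le_abs_self _).trans (hδK.trans_eq ?_))
    rw [Real.norm_of_nonneg (by linarith)]
  have hlog0 : 0 ≤ Real.log (1.25 / δ n) := by
    refine Real.log_nonneg ?_
    rw [le_div_iff₀ (hδ_pos n)]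
    linarith
  have hvar0 : 0 ≤ DPCP.noiseVar (DPCP.sensitivity ρ L lam n) (ε₁ n) (δ n) := by
    unfold DPCP.noiseVar
    positivity
  have hvar : DPCP.noiseVar (DPCP.sensitivity ρ L lam n) (ε₁ n) (δ n)
      ≤ V * Real.log n / (ε₁ n * n) ^ 2 := by
    refine (DPCP.noiseVar_sensitivity_le hε0 hn0 hlog).trans ?_
    gcongr
    linarith
  have hnoise := DPCP.measureReal_norm_noise_le hvar0 hV0 hε0 (by omega : 1 < n) ht hvar hζ
  set m : ℕ := ⌈B * x⌉₊ with hm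
  have hm1 : B * x ≤ m := Nat.le_ceil _
  have hm2 : (m : ℝ) ≤ (B + 1) * x := by
    have := Nat.ceil_lt_add_one (show 0 ≤ B * x by positivity)
    rw [← hm] at this
    linarith
  have hxm : x ≤ m := le_trans (le_mul_of_one_le_left (by linarith) (by linarith)) hm1
  have hkm := DPCP.rank_add_le hα1.le hnα hα0 hεα hm2
  have hk0 : 0 < DPCP.rank α n :=
    Nat.ceil_pos.2 (mul_pos (by linarith) (by linarith))
  have hkk' : DPCP.rank α n ≤ DPCP.rank (DPCP.adjLevel α (ε₁ n) (δ n)) n :=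
    Nat.ceil_mono (mul_le_mul_of_nonneg_right
      (by linarith [DPCP.adjLevel_le hα0.le hε0.le (hδ_pos n).le]) (by positivity))
  have hk'm := DPCP.rank_adjLevel_add_one_le hn0 hα hε0.le (hδ_pos n).le hδα hD.le hδD' hx hm1
  have hgap := DPCP.iid_orderStat_gap_le_of_holder ν hα hγ.1 hϵ₀ hlo hhi hε0 hε1 hn0 hnα hnϵ
    (by positivity) hS hεϵ hxm hm2 hkm hquant
  -- `A` is the event of a wide gap; on its complement, and for small noise, the intervals are close
  set A : Set (Fin (n + 1) → ℝ) := {R | |h| * S ^ γ * ε₁ n ^ γ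
    < DPCP.orderStat R (DPCP.rank α n + m) - DPCP.orderStat R (DPCP.rank α n)} with hA
  have hAm : MeasurableSet A := measurableSet_lt measurable_const
    ((DPCP.measurable_orderStat _).sub (DPCP.measurable_orderStat _))
  -- the oracle scores are the only ones whose approximation by an i.i.d. sample is needed
  set R : Ω → Fin (n + 1) → ℝ := fun ω i => DPCP.score μ (Z i ω) (ϑn1 ω) with hRdef
  have hRm : AEMeasurable R P := aemeasurable_pi_lambda _ hR1.1
  have hξ0 : 0 ≤ ξTV := (DPCP.tvDist_nonneg _ _).trans hR1.2
  have hTV : P.real (R ⁻¹' A) ≤ C₃ * (1 / x) + ξTV := by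
    have := Measure.isProbabilityMeasure_map hRm
    have h1 := (DPCP.measureReal_sub_le_tvDist (P.map R) (Measure.pi fun _ : Fin (n + 1) => ν)
      hAm).trans hR1.2
    rw [map_measureReal_apply_of_aemeasurable hRm hAm] at h1
    linarith
  -- `1 / n ≤ ε₁ ≤ ε₁ ^ γ` absorbs the sensitivity of the fit
  have hεγ : 1 / (n : ℝ) ≤ ε₁ n ^ γ := by
    have h1 : 1 / (n : ℝ) ≤ ε₁ n := by rwa [div_le_iff₀ hn]
    refine h1.trans ?_
    simpa using Real.rpow_le_rpow_of_exponent_ge hε0 hε1 hγ.2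
  have hd : (0 : ℝ) ≤ d := Nat.cast_nonneg d
  have hcov : {ω | C * (ε₁ n ^ γ + t) < volume.real (symmDiff
        (DPCP.oracleInterval μ α (fun i => Z i ω) (ϑn1 ω))
        (DPCP.differentialInterval μ (DPCP.adjLevel α (ε₁ n) (δ n)) (fun i => Z i ω)
          (ϑn ω + ζ ω)))} ⊆ R ⁻¹' A ∪ {ω | d * (√(2 * V) * t) < ‖ζ ω‖} := by
    intro ω hω
    by_contra hcon
    simp only [mem_union, mem_preimage, hA, mem_ofPred_eq, not_or, not_lt] at hcon
    obtain ⟨hc1, hc2⟩ := hcon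
    rw [mem_ofPred_eq] at hω
    refine absurd hω (not_lt.2 ?_)
    refine (DPCP.volume_symmDiff_intervals_le_of_good hn0 hlam (hconv _) hloss hmodel (hϑn ω)
      (hϑn1 ω) hk0 hkk' hk'm hkm hεγ hc2 hc1).trans ?_
    have h6 : 8 * ρ * L ^ 2 / lam * ε₁ n ^ γ + 4 * L * (d * (√(2 * V) * t))
        + 2 * (|h| * S ^ γ * ε₁ n ^ γ) = C₁ * ε₁ n ^ γ + C₂ * t := by
      rw [hC₁, hC₂]
      ring
    have h8 : 0 ≤ ε₁ n ^ γ := Real.rpow_nonneg hε0.le _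
    rw [h6, mul_add]
    exact add_le_add (mul_le_mul_of_nonneg_right (by linarith) h8)
      (mul_le_mul_of_nonneg_right (by linarith) ht.le)
  refine (measureReal_mono hcov).trans ((measureReal_union_le _ _).trans ?_)
  set e := Real.exp (-(ε₁ n ^ 2 * (n : ℝ) ^ 2 * t ^ 2 / Real.log n))
  have h1 : 2 * d * e ≤ C * e := mul_le_mul_of_nonneg_right (by linarith) (Real.exp_nonneg _)
  have h2 : C₃ * (1 / x) ≤ C * (1 / x) :=
    mul_le_mul_of_nonneg_right (by linarith) (by positivity)
  refine (add_le_add hTV hnoise).trans ?_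
  rw [mul_add]
  linarith
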